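/- Let $M$ be a smooth manifold of dimension $n\ge 3$ with a smooth Lorentzian metric $g$ of signature $(+,-,\dots,-)$. Let $\nabla$ be the Levi-Civita connection, and fix the sign of the Ricci tensor by $R_{\mu\nu}v^\mu w^\nu=-\operatorname{tr}\big(u\mapsto(\nabla_u\nabla_v-\nabla_v\nabla_u-\nabla_{[u,v]})w\big)$. Put $R=g^{\mu\nu}R_{\mu\nu}$, $G_{\mu\nu}=R_{\mu\nu}-\tfrac12Rg_{\mu\nu}$ and $\Box_g=g^{\mu\nu}\nabla_\mu\nabla_\nu$. Let $m\in\mathbb R$, let $\xi\in[0,2\xi_c]$ with $\xi_c=\frac{n-2}{4(n-1)}$, and let $\phi:M\to\mathbb R$ be a $C^2$ solution of the Klein–Gordon equation $(\Box_g+m^2+\xi R)\phi=0$. Let $$T_{\mu\nu}=(\nabla_\mu\phi)(\nabla_\nu\phi)+\tfrac12g_{\mu\nu}\big(m^2\phi^2-(\nabla\phi)^2\big)+\xi\big(g_{\mu\nu}\Box_g-\nabla_\mu\nabla_\nu-G_{\mu\nu}\big)\phi^2,\qquad (\nabla\phi)^2=g^{\mu\nu}(\nabla_\mu\phi)(\nabla_\nu\phi),$$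 be its stress-energy tensor and $T=g^{\mu\nu}T_{\mu\nu}$ the trace. Let $\gamma:I\to M$ be a timelike geodesic parametrized by proper time $\tau$ (so $g(\dot\gamma,\dot\gamma)=1$), where $I\subseteq\mathbb R$ is an open interval, and let $\rho=T_{\mu\nu}\dot\gamma^\mu\dot\gamma^\nu-\frac{T}{n-2}$ be the effective energy density along $\gamma$. Then for every real-valued $f\in C^2(\mathbb R)$ with compact support contained in $I$, both integrals below converge absolutely and $$\int_\gamma\rho\,f^2\,d\tau\;\ge\;-\int_\gamma\Big\{\frac{1-2\xi}{n-2}m^2f^2+\xi\Big(2(f')^2+R_{\mu\nu}\dot\gamma^\mu\dot\gamma^\nu f^2-\frac{2\xi}{n-2}Rf^2\Big)\Big\}\phi^2\,d\tau .$$ The lower bound involves the values of $\phi$ along $\gamma$, but not its derivatives. -/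

import Mathlib

set_option maxSynthPendingDepth 3

open Set MeasureTheory
open scoped Manifold ContDiff Topology

/-- A smooth Lorentzian metric on an `n`-dimensional smooth manifold, of signature `(+,-,…,-)`:
a smooth section `g` of the bundle of symmetric bilinear forms on the tangent spaces, such that
each tangent space has a basis `e₀, …, eₙ₋₁` with `g(e₀,e₀) = 1`, `g(eᵢ,eᵢ) = -1` for `i ≥ 1` and
`g(eᵢ,eⱼ) = 0` for `i ≠ j`. -/
structure LorentzMetric (n : ℕ) (M : Type*) [TopologicalSpace M]
    [ChartedSpace (EuclideanSpace ℝ (Fin n)) M] [IsManifold (𝓡 n) ∞ M] where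
  /-- The bilinear form on each tangent space. -/
  val (p : M) : TangentSpace (𝓡 n) p →L[ℝ] TangentSpace (𝓡 n) p →L[ℝ] ℝ
  symm (p : M) (v w : TangentSpace (𝓡 n) p) : val p v w = val p w v
  signature (p : M) : ∃ e : Module.Basis (Fin n) ℝ (TangentSpace (𝓡 n) p),
    ∀ i j : Fin n, val p (e i) (e j) = if i = j then (if (i : ℕ) = 0 then 1 else -1) else 0
  contMDiff : ContMDiff (𝓡 n)
    ((𝓡 n).prod 𝓘(ℝ, EuclideanSpace ℝ (Fin n) →L[ℝ] EuclideanSpace ℝ (Fin n) →L[ℝ] ℝ)) ∞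
    (fun p ↦ (Bundle.TotalSpace.mk' (EuclideanSpace ℝ (Fin n) →L[ℝ] EuclideanSpace ℝ (Fin n) →L[ℝ] ℝ)
      p (val p) : Bundle.TotalSpace
        (EuclideanSpace ℝ (Fin n) →L[ℝ] EuclideanSpace ℝ (Fin n) →L[ℝ] ℝ)
        (fun p : M ↦ TangentSpace (𝓡 n) p →L[ℝ] TangentSpace (𝓡 n) p →L[ℝ] ℝ)))

noncomputable section

namespace LorentzMetric

section Algebra

/-! Pointwise tensor algebra on a vector space `E`. -/

variable {E : Type*} [NormedAddCommGroup E] [NormedSpace ℝ E]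

/-- The trace `g^{μν} B_{μν}` of a bilinear form `B` with respect to a nondegenerate bilinear form
`G`, i.e. the trace of the endomorphism `G⁻¹ ∘ B` (both forms being read as maps from the space to
its dual). -/
def formTrace (G B : E →L[ℝ] E →L[ℝ] ℝ) : ℝ :=
  LinearMap.trace ℝ E (G.inverse ∘L B : E →L[ℝ] E).toLinearMap

/-- From `D u v w = ∂_u g(v,w)`, the Christoffel symbols of the first kind,
`(u, v, w) ↦ ½ (∂_u g(v,w) + ∂_v g(u,w) - ∂_w g(u,v))`. -/
def koszul (D : E →L[ℝ] E →L[ℝ] E →L[ℝ] ℝ) : E →L[ℝ] E →L[ℝ] E →L[ℝ] ℝ :=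
  (1 / 2 : ℝ) • (D + D.flip -
    (ContinuousLinearMap.flipₗᵢ ℝ E E ℝ).toContinuousLinearEquiv.toContinuousLinearMap ∘L D.flip)

/-- `koszul` written out. -/
theorem koszul_apply (D : E →L[ℝ] E →L[ℝ] E →L[ℝ] ℝ) (u v w : E) :
    koszul D u v w = 1 / 2 * (D u v w + D v u w - D w u v) := by
  rfl

/-- From the Christoffel symbols `Γ` and their derivative `DΓ` at a point, the curvature operator,
as an endomorphism in its first argument:
`u ↦ ∇_u ∇_v w - ∇_v ∇_u w`
`= (∂_u Γ)(v,w) - (∂_v Γ)(u,w) + Γ(u, Γ(v,w)) - Γ(v, Γ(u,w))`. -/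
def riemann (Γ : E →L[ℝ] E →L[ℝ] E) (DΓ : E →L[ℝ] E →L[ℝ] E →L[ℝ] E) (v w : E) : E →L[ℝ] E :=
  (DΓ.flip v).flip w - (DΓ v).flip w + Γ.flip (Γ v w) - Γ v ∘L Γ.flip w

/-- The bilinear form `(v, w) ↦ - tr (u ↦ R(u,v)w)`. -/
def ricciForm [FiniteDimensional ℝ E] (Γ : E →L[ℝ] E →L[ℝ] E)
    (DΓ : E →L[ℝ] E →L[ℝ] E →L[ℝ] E) : E →L[ℝ] E →L[ℝ] ℝ :=
  (LinearMap.mk₂ ℝ (fun v w ↦ LinearMap.trace ℝ E (-(riemann Γ DΓ v w).toLinearMap))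
    (fun v v' w ↦ by
      rw [← map_add]
      congr 1
      ext u : 1
      simp [riemann]
      abel)
    (fun c v w ↦ by
      rw [← map_smul]
      congr 1
      ext u : 1
      simp [riemann, smul_sub, smul_add])
    (fun v w w' ↦ by
      rw [← map_add]
      congr 1
      ext u : 1
      simp [riemann]
      abel)
    (fun c v w ↦ by
      rw [← map_smul]
      congr 1
      ext u : 1
      simp [riemann, smul_sub, smul_add])).toContinuousBilinearMap

end Algebra

variable {n : ℕ} {M : Type*} [TopologicalSpace M]
  [ChartedSpace (EuclideanSpace ℝ (Fin n)) M] [IsManifold (𝓡 n) ∞ M]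

/-! Mathlib's tangent space `TangentSpace (𝓡 n) p` is by definition the model space
`EuclideanSpace ℝ (Fin n)`, the identification being given by the preferred chart
`extChartAt (𝓡 n) p` at `p`. Tensors at `p` are accordingly multilinear maps on the model space, and
they are computed in the preferred chart at `p`. -/

/-- The metric at `p`, as a bilinear form on the model space. -/
def form (g : LorentzMetric n M) (p : M) :
    EuclideanSpace ℝ (Fin n) →L[ℝ] EuclideanSpace ℝ (Fin n) →L[ℝ] ℝ :=
  g.val p

/-- The metric in the coordinates of the preferred chart at `x`: the pullback of `g` under the
inverse of that chart, at the point `y` of the model space. -/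
def inChart (g : LorentzMetric n M) (x : M) (y : EuclideanSpace ℝ (Fin n)) :
    EuclideanSpace ℝ (Fin n) →L[ℝ] EuclideanSpace ℝ (Fin n) →L[ℝ] ℝ :=
  let A : EuclideanSpace ℝ (Fin n) →L[ℝ] EuclideanSpace ℝ (Fin n) :=
    mfderiv 𝓘(ℝ, EuclideanSpace ℝ (Fin n)) (𝓡 n) (extChartAt (𝓡 n) x).symm y
  (g.form ((extChartAt (𝓡 n) x).symm y)).bilinearComp A A

/-- Christoffel symbols `Γ(u, v) = Γ^k_{ij} uⁱ vʲ` of the Levi-Civita connection, in the chart at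
`x`, at the point `y`. -/
def christoffel (g : LorentzMetric n M) (x : M) (y : EuclideanSpace ℝ (Fin n)) :
    EuclideanSpace ℝ (Fin n) →L[ℝ] EuclideanSpace ℝ (Fin n) →L[ℝ] EuclideanSpace ℝ (Fin n) :=
  ContinuousLinearMap.compL ℝ (EuclideanSpace ℝ (Fin n)) (EuclideanSpace ℝ (Fin n) →L[ℝ] ℝ)
    (EuclideanSpace ℝ (Fin n)) (g.inChart x y).inverse ∘L koszul (fderiv ℝ (g.inChart x) y)

/-- The Ricci tensor `R_{μν}`, in the sign convention in which `R(v,w) = - tr (u ↦ R(u,v)w)`, with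
`R(u,v) = [∇_u,∇_v] - ∇_{[u,v]}`. (This is the convention `[-,-,-]` of Misner, Thorne and
Wheeler: the metric has signature `(+,-,…,-)`, the Raychaudhuri equation reads
`∇_U θ = R_{μν}U^μU^ν - …` and the Einstein equations read `G_{μν} = -8π T_{μν}`.) -/
def ricci (g : LorentzMetric n M) (p : M) :
    EuclideanSpace ℝ (Fin n) →L[ℝ] EuclideanSpace ℝ (Fin n) →L[ℝ] ℝ :=
  ricciForm (g.christoffel p (extChartAt (𝓡 n) p p))
    (fderiv ℝ (g.christoffel p) (extChartAt (𝓡 n) p p))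

/-- The trace `g^{μν} B_{μν}` of a bilinear form `B` at `p`. -/
def trace (g : LorentzMetric n M) (p : M)
    (B : EuclideanSpace ℝ (Fin n) →L[ℝ] EuclideanSpace ℝ (Fin n) →L[ℝ] ℝ) : ℝ :=
  formTrace (g.form p) B

/-- The Ricci scalar `R = g^{μν} R_{μν}`. -/
def scalarCurvature (g : LorentzMetric n M) (p : M) : ℝ :=
  g.trace p (g.ricci p)

/-- The Einstein tensor `G_{μν} = R_{μν} - ½ R g_{μν}`. -/
def einstein (g : LorentzMetric n M) (p : M) :
    EuclideanSpace ℝ (Fin n) →L[ℝ] EuclideanSpace ℝ (Fin n) →L[ℝ] ℝ :=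
  g.ricci p - (1 / 2 * g.scalarCurvature p) • g.form p

/-- The differential `∇_μ φ` of a function at `p`. -/
def grad (φ : M → ℝ) (p : M) : EuclideanSpace ℝ (Fin n) →L[ℝ] ℝ :=
  fderiv ℝ (φ ∘ (extChartAt (𝓡 n) p).symm) (extChartAt (𝓡 n) p p)

/-- `(∇φ)² = g^{μν} (∇_μ φ)(∇_ν φ)` at `p`. -/
def gradSq (g : LorentzMetric n M) (φ : M → ℝ) (p : M) : ℝ :=
  grad φ p ((g.form p).inverse (grad φ p))

/-- The covariant Hessian `∇_μ ∇_ν φ = ∂_μ ∂_ν φ - Γ^κ_{μν} ∂_κ φ` at `p`. -/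
def hess (g : LorentzMetric n M) (φ : M → ℝ) (p : M) :
    EuclideanSpace ℝ (Fin n) →L[ℝ] EuclideanSpace ℝ (Fin n) →L[ℝ] ℝ :=
  fderiv ℝ (fderiv ℝ (φ ∘ (extChartAt (𝓡 n) p).symm)) (extChartAt (𝓡 n) p p) -
    ContinuousLinearMap.compL ℝ (EuclideanSpace ℝ (Fin n)) (EuclideanSpace ℝ (Fin n)) ℝ
      (grad φ p) ∘L g.christoffel p (extChartAt (𝓡 n) p p)

/-- The d'Alembertian `□_g φ = g^{μν} ∇_μ ∇_ν φ`. -/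
def box (g : LorentzMetric n M) (φ : M → ℝ) (p : M) : ℝ :=
  g.trace p (g.hess φ p)

/-- The Klein–Gordon equation `(□_g + m² + ξ R) φ = 0`. -/
def IsKleinGordon (g : LorentzMetric n M) (m ξ : ℝ) (φ : M → ℝ) : Prop :=
  ∀ p : M, g.box φ p + m ^ 2 * φ p + ξ * g.scalarCurvature p * φ p = 0

/-- The stress-energy tensor of the non-minimally coupled scalar field,
`T_{μν} = (∇_μ φ)(∇_ν φ) + ½ g_{μν} (m² φ² - (∇φ)²) + ξ (g_{μν} □_g - ∇_μ ∇_ν - G_{μν}) φ²`. -/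
def stressEnergy (g : LorentzMetric n M) (m ξ : ℝ) (φ : M → ℝ) (p : M) :
    EuclideanSpace ℝ (Fin n) →L[ℝ] EuclideanSpace ℝ (Fin n) →L[ℝ] ℝ :=
  (grad φ p).smulRight (grad φ p)
    + (1 / 2 * (m ^ 2 * φ p ^ 2 - g.gradSq φ p)) • g.form p
    + ξ • (g.box (fun q ↦ φ q ^ 2) p • g.form p - g.hess (fun q ↦ φ q ^ 2) p
        - φ p ^ 2 • g.einstein p)

/-- The effective energy density `ρ = T_{μν} U^μ U^ν - T / (n - 2)`, `T = g^{μν} T_{μν}`, seen at `p`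
by an observer of `n`-velocity `U`. -/
def effectiveEnergyDensity (g : LorentzMetric n M) (m ξ : ℝ) (φ : M → ℝ) (p : M)
    (U : EuclideanSpace ℝ (Fin n)) : ℝ :=
  g.stressEnergy m ξ φ p U U - g.trace p (g.stressEnergy m ξ φ p) / ((n : ℝ) - 2)

/-- The velocity `γ̇(τ)` of a curve, as a tangent vector at `γ τ`. -/
def velocity (γ : ℝ → M) (τ : ℝ) : EuclideanSpace ℝ (Fin n) :=
  mfderiv 𝓘(ℝ, ℝ) (𝓡 n) γ τ (1 : ℝ)

/-- The curve `γ` in the coordinates of the preferred chart at `γ τ`. -/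
def inCoordinates (γ : ℝ → M) (τ s : ℝ) : EuclideanSpace ℝ (Fin n) :=
  extChartAt (𝓡 n) (γ τ) (γ s)

/-- `γ`, restricted to the open interval `I`, is a geodesic of `g`: it is `C²` there and satisfies
`ẍ^k + Γ^k_{ij} ẋ^i ẋ^j = 0`, at each parameter `τ ∈ I` in the chart at `γ τ`. -/
def IsGeodesicOn (g : LorentzMetric n M) (γ : ℝ → M) (I : Set ℝ) : Prop :=
  ContMDiffOn 𝓘(ℝ, ℝ) (𝓡 n) 2 γ I ∧
  ∀ τ ∈ I,
    deriv (deriv (inCoordinates γ τ)) τ + g.christoffel (γ τ) (inCoordinates γ τ τ)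
      (deriv (inCoordinates γ τ) τ) (deriv (inCoordinates γ τ) τ) = 0

/-- `γ` is a timelike geodesic on the open interval `I`, parametrized by proper time:
`g(γ̇, γ̇) = 1`. -/
def IsProperTimelikeGeodesicOn (g : LorentzMetric n M) (γ : ℝ → M) (I : Set ℝ) : Prop :=
  g.IsGeodesicOn γ I ∧ ∀ τ ∈ I, g.form (γ τ) (velocity γ τ) (velocity γ τ) = 1

end LorentzMetric

/-- The conformal coupling constant `ξ_c = (n - 2) / (4 (n - 1))`. -/
def conformalCoupling (n : ℕ) : ℝ := ((n : ℝ) - 2) / (4 * ((n : ℝ) - 1))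

end

/-!
The bound comes from an identity at each point followed by one integration by parts.

Pointwise, the Leibniz rules for `∇_μ∇_ν φ²` and `□φ²` and the Klein–Gordon equation turn the
effective energy density, for a unit timelike `U`, into
`ρ = (∇_U φ)² - (1-2ξ)/(n-2) m²φ² + 2ξ²/(n-2) Rφ² - 2ξ/(n-2) (∇φ)² - ξ U^μU^ν∇_μ∇_ν φ² - ξ R_UU φ²`
(`effectiveEnergyDensity_eq`). The reversed Cauchy–Schwarz inequality gives `(∇φ)² ≤ (∇_U φ)²`
(`gradSq_le`). Along a geodesic `∇_U φ` and `U^μU^ν∇_μ∇_ν φ²` are the derivatives `u'` and `(u²)''`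
of `u = φ ∘ γ` (`deriv_comp_curve`, `deriv_deriv_comp_geodesic`). So `ρ f²` plus the integrand of
the bound is at least
`(1 - 2ξ/(n-2)) (f u')² + 4ξ (f u')(f' u) + 2ξ (f' u)² - ξ (f² (u²)')'`.
The quadratic form is nonnegative exactly because `ξ ≤ 2ξ_c` (`quadratic_nonneg_of_mem_Icc`), and
the total derivative integrates to zero (`integral_deriv_sq_mul_deriv_eq_zero`).

Absolute convergence needs `R`, `R_UU` and `(∇φ)²` to be continuous along `γ`. They are defined
at each point through the preferred chart there, and that chart varies discontinuously with the
point, so their tensorial nature has to be proved: the Christoffel symbols obey the inhomogeneous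
transformation law under a change of coordinates (`fderiv_leviCivita_pullback`), and differentiating
that law shows that the curvature transforms as a tensor (`fderiv_riemann`). The quantities near a
point can then all be computed in one chart, where the metric is smooth (`contDiffOn_inChart`).
-/

/-! ### Bilinear forms and their traces -/

namespace LorentzMetric

section Algebra

variable {E : Type*} [NormedAddCommGroup E] [NormedSpace ℝ E]

theorem isInvertible_of_nondegenerate [FiniteDimensional ℝ E] {G : E →L[ℝ] E →L[ℝ] ℝ}
    (hG : ∀ v, (∀ w, G v w = 0) → v = 0) : G.IsInvertible := by
  have hinj : Function.Injective G.toLinearMap := by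
    rw [← LinearMap.ker_eq_bot, LinearMap.ker_eq_bot']
    intro v hv
    exact hG v fun w ↦ by
      have := congrArg (fun L : E →L[ℝ] ℝ ↦ L w) hv
      simpa using this
  have hdim : Module.finrank ℝ E = Module.finrank ℝ (E →L[ℝ] ℝ) := by
    rw [← (LinearMap.toContinuousLinearMap : (E →ₗ[ℝ] ℝ) ≃ₗ[ℝ] (E →L[ℝ] ℝ)).finrank_eq]
    exact Subspace.dual_finrank_eq.symm
  refine ⟨(LinearEquiv.ofInjectiveOfFinrankEq G.toLinearMap hinj hdim).toContinuousLinearEquiv, ?_⟩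
  ext v w
  rfl

theorem isInvertible_of_leftInverse [FiniteDimensional ℝ E] {L K : E →L[ℝ] E}
    (h : ∀ v, K (L v) = v) : L.IsInvertible := by
  have hinj : Function.Injective L.toLinearMap := fun v w hvw ↦ by
    rw [← h v, ← h w]
    exact congrArg K hvw
  refine ⟨(LinearEquiv.ofInjectiveEndo L.toLinearMap hinj).toContinuousLinearEquiv, ?_⟩
  ext v
  simp

theorem formTrace_add (G B C : E →L[ℝ] E →L[ℝ] ℝ) :
    formTrace G (B + C) = formTrace G B + formTrace G C := by
  simp [formTrace]

theorem formTrace_sub (G B C : E →L[ℝ] E →L[ℝ] ℝ) :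
    formTrace G (B - C) = formTrace G B - formTrace G C := by
  simp [formTrace]

theorem formTrace_smul (G : E →L[ℝ] E →L[ℝ] ℝ) (c : ℝ) (B : E →L[ℝ] E →L[ℝ] ℝ) :
    formTrace G (c • B) = c * formTrace G B := by
  simp [formTrace]

theorem formTrace_self [FiniteDimensional ℝ E] {G : E →L[ℝ] E →L[ℝ] ℝ} (hG : G.IsInvertible) :
    formTrace G G = Module.finrank ℝ E := by
  have : (G.inverse ∘L G : E →L[ℝ] E).toLinearMap = LinearMap.id := by
    ext v
    simp [hG.inverse_apply_self]
  rw [formTrace, this, LinearMap.trace_id]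

theorem formTrace_smulRight [FiniteDimensional ℝ E] (G : E →L[ℝ] E →L[ℝ] ℝ) (a : E →L[ℝ] ℝ) :
    formTrace G (a.smulRight a) = a (G.inverse a) := by
  have : (G.inverse ∘L a.smulRight a : E →L[ℝ] E).toLinearMap =
      a.toLinearMap.smulRight (G.inverse a) := by
    ext v
    simp
  rw [formTrace, this, LinearMap.trace_smulRight]
  rfl

theorem isInvertible_bilinearComp [FiniteDimensional ℝ E] {G : E →L[ℝ] E →L[ℝ] ℝ}
    (hG : G.IsInvertible) {L : E →L[ℝ] E} (hL : L.IsInvertible) :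
    (G.bilinearComp L L).IsInvertible := by
  refine isInvertible_of_nondegenerate fun v hv ↦ ?_
  apply hL.injective
  apply hG.injective
  ext w
  obtain ⟨w, rfl⟩ := hL.surjective w
  simpa using hv w

/-- The metric trace does not depend on the coordinates in which both forms are read. -/
theorem formTrace_bilinearComp [FiniteDimensional ℝ E] {G : E →L[ℝ] E →L[ℝ] ℝ}
    (hG : G.IsInvertible) {L : E →L[ℝ] E} (hL : L.IsInvertible) (B : E →L[ℝ] E →L[ℝ] ℝ) :
    formTrace (G.bilinearComp L L) (B.bilinearComp L L) = formTrace G B := by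
  have hGL := isInvertible_bilinearComp hG hL
  obtain ⟨e, rfl⟩ := hL
  have key : ((G.bilinearComp (e : E →L[ℝ] E) (e : E →L[ℝ] E)).inverse ∘L B.bilinearComp (e : E →L[ℝ] E) (e : E →L[ℝ] E) :
      E →L[ℝ] E).toLinearMap =
      e.symm.toLinearEquiv.conj (G.inverse ∘L B : E →L[ℝ] E).toLinearMap := by
    ext v
    have h : B.bilinearComp (e : E →L[ℝ] E) (e : E →L[ℝ] E) v =
        G.bilinearComp (e : E →L[ℝ] E) (e : E →L[ℝ] E) (e.symm (G.inverse (B (e v)))) := by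
      ext w
      simp [hG.self_apply_inverse]
    simp only [ContinuousLinearMap.coe_coe, ContinuousLinearMap.comp_apply]
    rw [h, hGL.inverse_apply_self]
    simp [LinearEquiv.conj_apply]
  rw [formTrace, key, LinearMap.trace_conj', formTrace]

theorem ricciForm_apply [FiniteDimensional ℝ E] (Γ : E →L[ℝ] E →L[ℝ] E)
    (DΓ : E →L[ℝ] E →L[ℝ] E →L[ℝ] E) (v w : E) :
    ricciForm Γ DΓ v w = LinearMap.trace ℝ E (-(riemann Γ DΓ v w).toLinearMap) := rfl

theorem riemann_apply (Γ : E →L[ℝ] E →L[ℝ] E) (DΓ : E →L[ℝ] E →L[ℝ] E →L[ℝ] E) (u v w : E) :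
    riemann Γ DΓ v w u = DΓ u v w - DΓ v u w + Γ u (Γ v w) - Γ v (Γ u w) := rfl

theorem continuous_trace_clm [FiniteDimensional ℝ E] :
    Continuous fun A : E →L[ℝ] E ↦ LinearMap.trace ℝ E A.toLinearMap :=
  (LinearMap.trace ℝ E ∘ₗ ContinuousLinearMap.coeLM ℝ).continuous_of_finiteDimensional

theorem continuous_ricciForm [FiniteDimensional ℝ E] :
    Continuous fun q : (E →L[ℝ] E →L[ℝ] E) × (E →L[ℝ] E →L[ℝ] E →L[ℝ] E) ↦
      ricciForm q.1 q.2 := by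
  refine continuous_clm_apply.2 fun v ↦ continuous_clm_apply.2 fun w ↦ ?_
  have : ∀ q : (E →L[ℝ] E →L[ℝ] E) × (E →L[ℝ] E →L[ℝ] E →L[ℝ] E), ricciForm q.1 q.2 v w =
      LinearMap.trace ℝ E (-riemann q.1 q.2 v w : E →L[ℝ] E).toLinearMap := fun q ↦ rfl
  simp_rw [this]
  refine continuous_trace_clm.comp (continuous_clm_apply.2 fun u ↦ ?_)
  simp only [neg_apply, riemann_apply]
  fun_prop

/-- If two curvature operators correspond to each other under a linear isomorphism, so do
their Ricci forms. -/
theorem ricciForm_eq_of_riemann_eq [FiniteDimensional ℝ E] {Γ Γ' : E →L[ℝ] E →L[ℝ] E}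
    {DΓ DΓ' : E →L[ℝ] E →L[ℝ] E →L[ℝ] E} {L : E →L[ℝ] E} (hL : L.IsInvertible) {v w : E}
    (h : ∀ u, L (riemann Γ DΓ v w u) = riemann Γ' DΓ' (L v) (L w) (L u)) :
    ricciForm Γ DΓ v w = ricciForm Γ' DΓ' (L v) (L w) := by
  obtain ⟨e, rfl⟩ := hL
  rw [ricciForm_apply, ricciForm_apply, ← LinearMap.trace_conj' _ e.toLinearEquiv]
  congr 1
  ext u
  have := h (e.symm u)
  simp only [ContinuousLinearEquiv.coe_coe, ContinuousLinearEquiv.apply_symm_apply] at this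
  simp [LinearEquiv.conj_apply, this]

end Algebra

/-! ### Change of coordinates for the Christoffel symbols and the curvature -/

section Calculus

variable {E : Type*} [NormedAddCommGroup E] [NormedSpace ℝ E]

theorem contDiff_koszul [FiniteDimensional ℝ E] {k : ℕ∞ω} :
    ContDiff ℝ k (koszul : (E →L[ℝ] E →L[ℝ] E →L[ℝ] ℝ) → E →L[ℝ] E →L[ℝ] E →L[ℝ] ℝ) := by
  refine contDiff_clm_apply_iff.2 fun u ↦ contDiff_clm_apply_iff.2 fun v ↦
    contDiff_clm_apply_iff.2 fun w ↦ ?_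
  simp only [koszul_apply]
  fun_prop

/-- The Christoffel symbols of the second kind of a field `h` of bilinear forms on `E`. -/
noncomputable def leviCivita (h : E → E →L[ℝ] E →L[ℝ] ℝ) (y : E) : E →L[ℝ] E →L[ℝ] E :=
  ContinuousLinearMap.compL ℝ E (E →L[ℝ] ℝ) E (h y).inverse ∘L koszul (fderiv ℝ h y)

theorem apply_leviCivita {h : E → E →L[ℝ] E →L[ℝ] ℝ} {y : E} (hy : (h y).IsInvertible)
    (u v w : E) : h y (leviCivita h y u v) w = koszul (fderiv ℝ h y) u v w := by
  have : leviCivita h y u v = (h y).inverse (koszul (fderiv ℝ h y) u v) := rfl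
  rw [this, hy.self_apply_inverse]

theorem hasFDerivAt_clm_apply_const {F : Type*} [NormedAddCommGroup F] [NormedSpace ℝ F]
    {A : E → E →L[ℝ] F} {A' : E →L[ℝ] E →L[ℝ] F} {z : E} (a : E) (hA : HasFDerivAt A A' z) :
    HasFDerivAt (fun z ↦ A z a) (A'.flip a) z := by
  simpa using hA.clm_apply (hasFDerivAt_const a z)

/-- The derivative of the pullback of a field of bilinear forms. -/
theorem fderiv_pullback_apply {h h' : E → E →L[ℝ] E →L[ℝ] ℝ} {ψ : E → E} {y : E}
    (hψ : ContDiffAt ℝ 2 ψ y) (hh' : DifferentiableAt ℝ h' (ψ y))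
    (heq : h =ᶠ[𝓝 y] fun z ↦ (h' (ψ z)).bilinearComp (fderiv ℝ ψ z) (fderiv ℝ ψ z))
    (hh : DifferentiableAt ℝ h y) (u v w : E) :
    fderiv ℝ h y u v w =
      fderiv ℝ h' (ψ y) (fderiv ℝ ψ y u) (fderiv ℝ ψ y v) (fderiv ℝ ψ y w)
        + h' (ψ y) (fderiv ℝ (fderiv ℝ ψ) y u v) (fderiv ℝ ψ y w)
        + h' (ψ y) (fderiv ℝ ψ y v) (fderiv ℝ (fderiv ℝ ψ) y u w) := by
  have hψ1 : HasFDerivAt ψ (fderiv ℝ ψ y) y := (hψ.differentiableAt two_ne_zero).hasFDerivAt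
  have hψ2 : HasFDerivAt (fderiv ℝ ψ) (fderiv ℝ (fderiv ℝ ψ) y) y :=
    ((hψ.fderiv_right (m := 1) le_rfl).differentiableAt one_ne_zero).hasFDerivAt
  have h1 : HasFDerivAt (fun z ↦ h z v w) (((fderiv ℝ h y).flip v).flip w) y :=
    hasFDerivAt_clm_apply_const w (hasFDerivAt_clm_apply_const v hh.hasFDerivAt)
  have h2 := ((hh'.hasFDerivAt.comp y hψ1).clm_apply (hasFDerivAt_clm_apply_const v hψ2)).clm_apply
    (hasFDerivAt_clm_apply_const w hψ2)
  have heq' : (fun z ↦ h z v w) =ᶠ[𝓝 y]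
      fun z ↦ h' (ψ z) (fderiv ℝ ψ z v) (fderiv ℝ ψ z w) := by
    filter_upwards [heq] with z hz
    rw [hz]
    rfl
  have h3 := congrArg (fun A : E →L[ℝ] ℝ ↦ A u) (h1.unique (h2.congr_of_eventuallyEq heq'))
  simp at h3
  rw [h3]
  ring

/-- The transformation law of the Christoffel symbols of a metric under a change of coordinates
`ψ`: they differ from a tensor by the second derivative of `ψ`. -/
theorem fderiv_leviCivita_pullback {h h' : E → E →L[ℝ] E →L[ℝ] ℝ} {ψ : E → E} {y : E}
    (hψ : ContDiffAt ℝ 2 ψ y) (hh' : DifferentiableAt ℝ h' (ψ y))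
    (heq : h =ᶠ[𝓝 y] fun z ↦ (h' (ψ z)).bilinearComp (fderiv ℝ ψ z) (fderiv ℝ ψ z))
    (hh : DifferentiableAt ℝ h y) (hinv : (h y).IsInvertible) (hinv' : (h' (ψ y)).IsInvertible)
    (hL : (fderiv ℝ ψ y).IsInvertible) (hsymm : ∀ v w, h' (ψ y) v w = h' (ψ y) w v) (u v : E) :
    fderiv ℝ ψ y (leviCivita h y u v) =
      leviCivita h' (ψ y) (fderiv ℝ ψ y u) (fderiv ℝ ψ y v) + fderiv ℝ (fderiv ℝ ψ) y u v := by
  -- compare both sides through `h'`, where lowering the index turns them into Koszul expressions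
  apply hinv'.injective
  ext w
  obtain ⟨w, rfl⟩ := hL.surjective w
  have h1 : h' (ψ y) (fderiv ℝ ψ y (leviCivita h y u v)) (fderiv ℝ ψ y w) =
      koszul (fderiv ℝ h y) u v w := by
    rw [← apply_leviCivita hinv, heq.eq_of_nhds]
    rfl
  have hsym2 : IsSymmSndFDerivAt ℝ ψ y := hψ.isSymmSndFDerivAt (by simp)
  rw [h1, map_add, add_apply, apply_leviCivita hinv', koszul_apply,
    koszul_apply]
  simp only [fderiv_pullback_apply hψ hh' heq hh]
  rw [hsym2.eq v u, hsym2.eq w u, hsym2.eq w v,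
    hsymm (fderiv ℝ ψ y v) (fderiv ℝ (fderiv ℝ ψ) y u w),
    hsymm (fderiv ℝ ψ y u) (fderiv ℝ (fderiv ℝ ψ) y v w)]
  ring

/-- Connection coefficients obeying the inhomogeneous transformation law near a point have
curvatures related by the tensorial one there. -/
theorem fderiv_riemann {Γ Γ' : E → E →L[ℝ] E →L[ℝ] E} {ψ : E → E} {y : E}
    (hψ : ContDiffAt ℝ 3 ψ y) (hΓ : DifferentiableAt ℝ Γ y) (hΓ' : DifferentiableAt ℝ Γ' (ψ y))
    (heq : ∀ᶠ z in 𝓝 y, ∀ u v, fderiv ℝ ψ z (Γ z u v) =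
      Γ' (ψ z) (fderiv ℝ ψ z u) (fderiv ℝ ψ z v) + fderiv ℝ (fderiv ℝ ψ) z u v) (u v w : E) :
    fderiv ℝ ψ y (riemann (Γ y) (fderiv ℝ Γ y) v w u) =
      riemann (Γ' (ψ y)) (fderiv ℝ Γ' (ψ y)) (fderiv ℝ ψ y v) (fderiv ℝ ψ y w)
        (fderiv ℝ ψ y u) := by
  have hψd : ContDiffAt ℝ 2 (fderiv ℝ ψ) y := hψ.fderiv_right (m := 2) le_rfl
  have hψ1 : HasFDerivAt ψ (fderiv ℝ ψ y) y := (hψ.differentiableAt three_ne_zero).hasFDerivAt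
  have hψ2 : HasFDerivAt (fderiv ℝ ψ) (fderiv ℝ (fderiv ℝ ψ) y) y :=
    (hψd.differentiableAt two_ne_zero).hasFDerivAt
  have hψ3 : HasFDerivAt (fderiv ℝ (fderiv ℝ ψ)) (fderiv ℝ (fderiv ℝ (fderiv ℝ ψ)) y) y :=
    ((hψd.fderiv_right (m := 1) le_rfl).differentiableAt one_ne_zero).hasFDerivAt
  -- the transformation law of `Γ`, differentiated in the direction `x`
  have key : ∀ x a b : E, fderiv ℝ ψ y (fderiv ℝ Γ y x a b) =
      fderiv ℝ Γ' (ψ y) (fderiv ℝ ψ y x) (fderiv ℝ ψ y a) (fderiv ℝ ψ y b)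
        + Γ' (ψ y) (fderiv ℝ (fderiv ℝ ψ) y x a) (fderiv ℝ ψ y b)
        + Γ' (ψ y) (fderiv ℝ ψ y a) (fderiv ℝ (fderiv ℝ ψ) y x b)
        + fderiv ℝ (fderiv ℝ (fderiv ℝ ψ)) y x a b
        - fderiv ℝ (fderiv ℝ ψ) y x (Γ y a b) := by
    intro x a b
    have h1 := hψ2.clm_apply (hasFDerivAt_clm_apply_const b (hasFDerivAt_clm_apply_const a hΓ.hasFDerivAt))
    have h2 := (((hΓ'.hasFDerivAt.comp y hψ1).clm_apply (hasFDerivAt_clm_apply_const a hψ2)).clm_apply (hasFDerivAt_clm_apply_const b hψ2)).add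
      (hasFDerivAt_clm_apply_const b (hasFDerivAt_clm_apply_const a hψ3))
    have h3 := h1.unique (h2.congr_of_eventuallyEq (heq.mono fun z hz ↦ hz a b))
    have h4 := congrArg (fun A : E →L[ℝ] E ↦ A x) h3
    simp at h4
    rw [eq_sub_iff_add_eq, h4]
    abel
  have h0 := heq.self_of_nhds
  have hs2 : IsSymmSndFDerivAt ℝ ψ y := (hψ.of_le (by norm_num)).isSymmSndFDerivAt (n := 2) (by simp)
  have hs3 : IsSymmSndFDerivAt ℝ (fderiv ℝ ψ) y := hψd.isSymmSndFDerivAt (by simp)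
  rw [riemann_apply, riemann_apply, map_sub, map_add, map_sub, key, key, h0, h0, h0, h0,
    hs3.eq v u, hs2.eq v u]
  simp only [map_add]
  abel

end Calculus

/-! ### Transition maps between the preferred charts -/

section Charts

variable {n : ℕ} {M : Type*} [TopologicalSpace M]
  [ChartedSpace (EuclideanSpace ℝ (Fin n)) M]

/-- The transition map from the preferred chart at `x` to the preferred chart at `q`. -/
noncomputable def transition (n : ℕ) {M : Type*} [TopologicalSpace M]
    [ChartedSpace (EuclideanSpace ℝ (Fin n)) M] (x q : M) :
    EuclideanSpace ℝ (Fin n) → EuclideanSpace ℝ (Fin n) :=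
  extChartAt (𝓡 n) q ∘ (extChartAt (𝓡 n) x).symm

/-- The domain of the transition map from the chart at `x` to the chart at `q`. -/
def overlap (n : ℕ) {M : Type*} [TopologicalSpace M]
    [ChartedSpace (EuclideanSpace ℝ (Fin n)) M] (x q : M) : Set (EuclideanSpace ℝ (Fin n)) :=
  (extChartAt (𝓡 n) x).target ∩ (extChartAt (𝓡 n) x).symm ⁻¹' (extChartAt (𝓡 n) q).source

theorem isOpen_overlap (x q : M) : IsOpen (overlap n x q) :=
  (continuousOn_extChartAt_symm x).isOpen_inter_preimage (isOpen_extChartAt_target x)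
    (isOpen_extChartAt_source q)

theorem mem_overlap_symm {x : M} {y : EuclideanSpace ℝ (Fin n)}
    (hy : y ∈ (extChartAt (𝓡 n) x).target) : y ∈ overlap n x ((extChartAt (𝓡 n) x).symm y) :=
  ⟨hy, mem_extChartAt_source _⟩

theorem transition_mem_overlap {x q : M} {y : EuclideanSpace ℝ (Fin n)} (hy : y ∈ overlap n x q) :
    transition n x q y ∈ overlap n q x := by
  refine ⟨(extChartAt (𝓡 n) q).map_source hy.2, ?_⟩
  simp only [transition, mem_preimage, Function.comp_apply]
  rw [(extChartAt (𝓡 n) q).left_inv hy.2]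
  exact (extChartAt (𝓡 n) x).map_target hy.1

theorem symm_transition {x q : M} {y : EuclideanSpace ℝ (Fin n)} (hy : y ∈ overlap n x q) :
    (extChartAt (𝓡 n) q).symm (transition n x q y) = (extChartAt (𝓡 n) x).symm y :=
  (extChartAt (𝓡 n) q).left_inv hy.2

theorem transition_transition {x q r : M} {y : EuclideanSpace ℝ (Fin n)} (hy : y ∈ overlap n x q) :
    transition n q r (transition n x q y) = transition n x r y := by
  simp only [transition, Function.comp_apply]
  rw [(extChartAt (𝓡 n) q).left_inv hy.2]

theorem transition_self {x : M} {y : EuclideanSpace ℝ (Fin n)}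
    (hy : y ∈ (extChartAt (𝓡 n) x).target) : transition n x x y = y :=
  (extChartAt (𝓡 n) x).right_inv hy

variable [IsManifold (𝓡 n) ∞ M]

theorem contDiffAt_transition {x q : M} {y : EuclideanSpace ℝ (Fin n)} (hy : y ∈ overlap n x q) :
    ContDiffAt ℝ ∞ (transition n x q) y := by
  have := contDiffWithinAt_ext_coord_change (I := 𝓡 n) (n := ∞) q x (y := y) (by
    rw [PartialEquiv.trans_source, PartialEquiv.symm_source]
    exact hy)
  rwa [modelWithCornersSelf_coe, range_id, contDiffWithinAt_univ] at this

theorem differentiableAt_transition {x q : M} {y : EuclideanSpace ℝ (Fin n)}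
    (hy : y ∈ overlap n x q) : DifferentiableAt ℝ (transition n x q) y :=
  (contDiffAt_transition hy).differentiableAt (by simp)

theorem fderiv_transition_comp {x q r : M} {y : EuclideanSpace ℝ (Fin n)}
    (hy : y ∈ overlap n x q) (hr : y ∈ overlap n x r) :
    fderiv ℝ (transition n x r) y =
      fderiv ℝ (transition n q r) (transition n x q y) ∘L fderiv ℝ (transition n x q) y := by
  have hqr : transition n x q y ∈ overlap n q r :=
    ⟨(transition_mem_overlap hy).1, by rw [mem_preimage, symm_transition hy]; exact hr.2⟩
  rw [← fderiv_comp y (differentiableAt_transition hqr) (differentiableAt_transition hy)]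
  refine Filter.EventuallyEq.fderiv_eq ?_
  filter_upwards [(isOpen_overlap x q).mem_nhds hy] with z hz
  exact (transition_transition hz).symm

omit [IsManifold (𝓡 n) ∞ M] in
theorem fderiv_transition_self {x : M} {y : EuclideanSpace ℝ (Fin n)}
    (hy : y ∈ (extChartAt (𝓡 n) x).target) :
    fderiv ℝ (transition n x x) y = ContinuousLinearMap.id ℝ _ := by
  rw [← fderiv_id (x := y)]
  refine Filter.EventuallyEq.fderiv_eq ?_
  filter_upwards [(isOpen_extChartAt_target x).mem_nhds hy] with z hz
  exact transition_self hz

theorem isInvertible_fderiv_transition {x q : M} {y : EuclideanSpace ℝ (Fin n)}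
    (hy : y ∈ overlap n x q) : (fderiv ℝ (transition n x q) y).IsInvertible := by
  refine isInvertible_of_leftInverse (K := fderiv ℝ (transition n q x) (transition n x q y))
    fun v ↦ ?_
  have := fderiv_transition_comp hy (r := x) ⟨hy.1, (extChartAt (𝓡 n) x).map_target hy.1⟩
  rw [fderiv_transition_self hy.1] at this
  exact (congrArg (fun A : _ →L[ℝ] _ ↦ A v) this).symm

theorem mfderiv_extChartAt_symm {x : M} {y : EuclideanSpace ℝ (Fin n)}
    (hy : y ∈ (extChartAt (𝓡 n) x).target) :
    (mfderiv 𝓘(ℝ, EuclideanSpace ℝ (Fin n)) (𝓡 n) (extChartAt (𝓡 n) x).symm y :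
      EuclideanSpace ℝ (Fin n) →L[ℝ] EuclideanSpace ℝ (Fin n)) =
      fderiv ℝ (transition n x ((extChartAt (𝓡 n) x).symm y)) y := by
  have hd : MDifferentiableAt 𝓘(ℝ, EuclideanSpace ℝ (Fin n)) (𝓡 n)
      (extChartAt (𝓡 n) x).symm y :=
    ((contMDiffOn_extChartAt_symm (n := ∞) x).contMDiffAt
      ((isOpen_extChartAt_target x).mem_nhds hy)).mdifferentiableAt (by simp)
  refine hd.mfderiv.trans ?_
  rw [modelWithCornersSelf_coe, range_id, fderivWithin_univ]
  rfl

/-! ### The metric in a chart -/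

theorem inChart_eq (g : LorentzMetric n M) {x : M} {y : EuclideanSpace ℝ (Fin n)}
    (hy : y ∈ (extChartAt (𝓡 n) x).target) :
    g.inChart x y = (g.form ((extChartAt (𝓡 n) x).symm y)).bilinearComp
      (fderiv ℝ (transition n x ((extChartAt (𝓡 n) x).symm y)) y)
      (fderiv ℝ (transition n x ((extChartAt (𝓡 n) x).symm y)) y) := by
  rw [← mfderiv_extChartAt_symm hy]
  rfl

theorem inChart_center (g : LorentzMetric n M) (p : M) :
    g.inChart p (extChartAt (𝓡 n) p p) = g.form p := by
  rw [inChart_eq g (mem_extChartAt_target p), extChartAt_to_inv,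
    fderiv_transition_self (mem_extChartAt_target p)]
  rfl

/-- The coordinate expressions of the metric in two charts are pullbacks of each other. -/
theorem inChart_eq_pullback (g : LorentzMetric n M) {x q : M} {y : EuclideanSpace ℝ (Fin n)}
    (hy : y ∈ overlap n x q) :
    g.inChart x y = (g.inChart q (transition n x q y)).bilinearComp
      (fderiv ℝ (transition n x q) y) (fderiv ℝ (transition n x q) y) := by
  rw [inChart_eq g hy.1, inChart_eq g (transition_mem_overlap hy).1, symm_transition hy,
    fderiv_transition_comp hy (mem_overlap_symm hy.1)]
  rfl

theorem form_symm (g : LorentzMetric n M) (p : M) (v w : EuclideanSpace ℝ (Fin n)) :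
    g.form p v w = g.form p w v := g.symm p v w

/-- The signature, in terms of an orthonormal basis of the model space. -/
theorem exists_orthonormal_basis (g : LorentzMetric n M) (p : M) :
    ∃ e : Module.Basis (Fin n) ℝ (EuclideanSpace ℝ (Fin n)), ∀ i j : Fin n,
      g.form p (e i) (e j) = if i = j then (if (i : ℕ) = 0 then 1 else -1) else 0 :=
  g.signature p

theorem isInvertible_form (g : LorentzMetric n M) (p : M) : (g.form p).IsInvertible := by
  obtain ⟨e, he⟩ := g.exists_orthonormal_basis p
  refine isInvertible_of_nondegenerate fun v hv ↦ ?_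
  rw [← e.sum_repr v] at hv
  refine e.ext_elem fun i ↦ ?_
  have := hv (e i)
  simp only [map_sum, map_smul, sum_apply, smul_apply, he, smul_eq_mul,
    mul_ite, mul_zero, Finset.sum_ite_eq', Finset.mem_univ, if_true] at this
  split_ifs at this <;> simpa using this

theorem isInvertible_inChart (g : LorentzMetric n M) {x : M} {y : EuclideanSpace ℝ (Fin n)}
    (hy : y ∈ (extChartAt (𝓡 n) x).target) : (g.inChart x y).IsInvertible := by
  rw [inChart_eq g hy]
  exact isInvertible_bilinearComp (g.isInvertible_form _)
    (isInvertible_fderiv_transition (mem_overlap_symm hy))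

theorem inChart_symm (g : LorentzMetric n M) {x : M} (y v w : EuclideanSpace ℝ (Fin n)) :
    g.inChart x y v w = g.inChart x y w v := g.form_symm _ _ _

/-- The coordinate vector fields of the chart at `x` are smooth sections of the tangent bundle. -/
theorem contMDiffAt_coordinateField {x : M} {y : EuclideanSpace ℝ (Fin n)}
    (hy : y ∈ (extChartAt (𝓡 n) x).target) (v : EuclideanSpace ℝ (Fin n)) :
    ContMDiffAt 𝓘(ℝ, EuclideanSpace ℝ (Fin n)) (𝓡 n).tangent ∞
      (fun z ↦ (⟨(extChartAt (𝓡 n) x).symm z,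
        mfderiv 𝓘(ℝ, EuclideanSpace ℝ (Fin n)) (𝓡 n) (extChartAt (𝓡 n) x).symm z v⟩ :
        TangentBundle (𝓡 n) M)) y := by
  rw [Bundle.contMDiffAt_totalSpace]
  refine ⟨(contMDiffOn_extChartAt_symm (n := ∞) x).contMDiffAt
      ((isOpen_extChartAt_target x).mem_nhds hy), ?_⟩
  have hs : ContDiffAt ℝ ∞
      (fun z ↦ fderiv ℝ (transition n x ((extChartAt (𝓡 n) x).symm y)) z v) y :=
    ((contDiffAt_transition (mem_overlap_symm hy)).fderiv_right (m := ∞) (by simp)).clm_apply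
      contDiffAt_const
  refine hs.contMDiffAt.congr_of_eventuallyEq ?_
  filter_upwards [(isOpen_overlap x _).mem_nhds (mem_overlap_symm hy)] with z hz
  have hA := congrArg (fun A : EuclideanSpace ℝ (Fin n) →L[ℝ] EuclideanSpace ℝ (Fin n) ↦ A v)
    (mfderiv_extChartAt_symm hz.1)
  rw [fderiv_transition_comp (mem_overlap_symm hz.1) hz]
  refine Eq.trans ?_ (congrArg (fderiv ℝ (transition n ((extChartAt (𝓡 n) x).symm z)
    ((extChartAt (𝓡 n) x).symm y)) (transition n x ((extChartAt (𝓡 n) x).symm z) z)) hA)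
  rw [TangentBundle.trivializationAt_apply, modelWithCornersSelf_coe, range_id, fderivWithin_univ]
  rfl

/-- The coordinate expression of the metric is smooth on the domain of the chart. -/
theorem contDiffOn_inChart (g : LorentzMetric n M) (x : M) :
    ContDiffOn ℝ ∞ (g.inChart x) (extChartAt (𝓡 n) x).target := by
  refine contDiffOn_clm_apply.2 fun v ↦ contDiffOn_clm_apply.2 fun w y hy ↦ ?_
  have hs : ContMDiffAt 𝓘(ℝ, EuclideanSpace ℝ (Fin n)) (𝓡 n) ∞ (extChartAt (𝓡 n) x).symm y :=
    (contMDiffOn_extChartAt_symm (n := ∞) x).contMDiffAt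
      ((isOpen_extChartAt_target x).mem_nhds hy)
  have : ContMDiffAt 𝓘(ℝ, EuclideanSpace ℝ (Fin n)) ((𝓡 n).prod 𝓘(ℝ)) ∞
      (fun z ↦ Bundle.TotalSpace.mk' ℝ (E := Bundle.Trivial M ℝ) ((extChartAt (𝓡 n) x).symm z)
        (g.val ((extChartAt (𝓡 n) x).symm z)
          (mfderiv 𝓘(ℝ, EuclideanSpace ℝ (Fin n)) (𝓡 n) (extChartAt (𝓡 n) x).symm z v)
          (mfderiv 𝓘(ℝ, EuclideanSpace ℝ (Fin n)) (𝓡 n) (extChartAt (𝓡 n) x).symm z w))) y := by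
    apply ContMDiffAt.clm_bundle_apply₂ (F₁ := EuclideanSpace ℝ (Fin n))
      (F₂ := EuclideanSpace ℝ (Fin n))
    · exact ContMDiffAt.comp y g.contMDiff.contMDiffAt hs
    · exact contMDiffAt_coordinateField hy v
    · exact contMDiffAt_coordinateField hy w
  rw [Bundle.contMDiffAt_totalSpace] at this
  exact this.2.contDiffAt.contDiffWithinAt

theorem contDiffAt_inChart (g : LorentzMetric n M) {x : M} {y : EuclideanSpace ℝ (Fin n)}
    (hy : y ∈ (extChartAt (𝓡 n) x).target) : ContDiffAt ℝ ∞ (g.inChart x) y :=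
  (g.contDiffOn_inChart x).contDiffAt ((isOpen_extChartAt_target x).mem_nhds hy)

theorem differentiableAt_inChart (g : LorentzMetric n M) {x : M} {y : EuclideanSpace ℝ (Fin n)}
    (hy : y ∈ (extChartAt (𝓡 n) x).target) : DifferentiableAt ℝ (g.inChart x) y :=
  (g.contDiffAt_inChart hy).differentiableAt (by simp)

/-! ### Christoffel symbols and Ricci tensor in different charts -/

theorem contDiffAt_christoffel (g : LorentzMetric n M) {x : M} {y : EuclideanSpace ℝ (Fin n)}
    (hy : y ∈ (extChartAt (𝓡 n) x).target) : ContDiffAt ℝ ∞ (g.christoffel x) y := by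
  have h1 : ContDiffAt ℝ ∞ (fun z ↦ (g.inChart x z).inverse) y :=
    ContDiffAt.comp y (g.isInvertible_inChart hy).contDiffAt_map_inverse (g.contDiffAt_inChart hy)
  have h2 : ContDiffAt ℝ ∞ (fderiv ℝ (g.inChart x)) y :=
    (g.contDiffAt_inChart hy).fderiv_right (m := ∞) (by simp)
  have h3 : ContDiffAt ℝ ∞ (fun z ↦ koszul (fderiv ℝ (g.inChart x) z)) y :=
    contDiff_koszul.contDiffAt.comp y h2
  exact ((ContinuousLinearMap.compL ℝ (EuclideanSpace ℝ (Fin n)) (EuclideanSpace ℝ (Fin n) →L[ℝ] ℝ)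
    (EuclideanSpace ℝ (Fin n))).contDiff.contDiffAt.comp y h1).clm_comp h3

theorem fderiv_transition_christoffel (g : LorentzMetric n M) {x q : M}
    {y : EuclideanSpace ℝ (Fin n)} (hy : y ∈ overlap n x q) (u v : EuclideanSpace ℝ (Fin n)) :
    fderiv ℝ (transition n x q) y (g.christoffel x y u v) =
      g.christoffel q (transition n x q y) (fderiv ℝ (transition n x q) y u)
        (fderiv ℝ (transition n x q) y v) + fderiv ℝ (fderiv ℝ (transition n x q)) y u v := by
  refine fderiv_leviCivita_pullback ((contDiffAt_transition hy).of_le (by norm_cast))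
    (g.differentiableAt_inChart (transition_mem_overlap hy).1) ?_
    (g.differentiableAt_inChart hy.1) (g.isInvertible_inChart hy.1)
    (g.isInvertible_inChart (transition_mem_overlap hy).1) (isInvertible_fderiv_transition hy)
    (g.inChart_symm _) u v
  filter_upwards [(isOpen_overlap x q).mem_nhds hy] with z hz using g.inChart_eq_pullback hz

/-- The Ricci tensor computed in the chart at `x`, at the point with coordinates `y`. -/
noncomputable def ricciInChart (g : LorentzMetric n M) (x : M) (y : EuclideanSpace ℝ (Fin n)) :
    EuclideanSpace ℝ (Fin n) →L[ℝ] EuclideanSpace ℝ (Fin n) →L[ℝ] ℝ :=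
  ricciForm (g.christoffel x y) (fderiv ℝ (g.christoffel x) y)

theorem ricciInChart_eq_pullback (g : LorentzMetric n M) {x q : M} {y : EuclideanSpace ℝ (Fin n)}
    (hy : y ∈ overlap n x q) :
    g.ricciInChart x y = (g.ricciInChart q (transition n x q y)).bilinearComp
      (fderiv ℝ (transition n x q) y) (fderiv ℝ (transition n x q) y) := by
  ext v w : 2
  change ricciForm (g.christoffel x y) (fderiv ℝ (g.christoffel x) y) v w =
    ricciForm (g.christoffel q (transition n x q y))
      (fderiv ℝ (g.christoffel q) (transition n x q y)) (fderiv ℝ (transition n x q) y v)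
      (fderiv ℝ (transition n x q) y w)
  refine ricciForm_eq_of_riemann_eq (isInvertible_fderiv_transition hy) fun u ↦ ?_
  refine fderiv_riemann ((contDiffAt_transition hy).of_le (by norm_cast))
    ((g.contDiffAt_christoffel hy.1).differentiableAt (by simp))
    ((g.contDiffAt_christoffel (transition_mem_overlap hy).1).differentiableAt (by simp)) ?_ u v w
  filter_upwards [(isOpen_overlap x q).mem_nhds hy] with z hz u v
  exact g.fderiv_transition_christoffel hz u v

theorem continuousOn_ricciInChart (g : LorentzMetric n M) (x : M) :
    ContinuousOn (g.ricciInChart x) (extChartAt (𝓡 n) x).target := fun y hy ↦ by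
  have h := g.contDiffAt_christoffel hy
  have h' : ContinuousAt (fderiv ℝ (g.christoffel x)) y :=
    (h.fderiv_right (m := ∞) (by simp)).continuousAt
  exact (continuous_ricciForm.continuousAt.comp (h.continuousAt.prodMk h')).continuousWithinAt

/-! ### Tensors at a point, read in the chart at another point -/

/-- The derivative at `p` of the transition map from the chart at `x` to the chart at `p`: the
tangent vector at `p` with components `v` in the chart at `x` is `chartJacobian x p v`. -/
noncomputable def chartJacobian (n : ℕ) {M : Type*} [TopologicalSpace M]
    [ChartedSpace (EuclideanSpace ℝ (Fin n)) M] (x p : M) :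
    EuclideanSpace ℝ (Fin n) →L[ℝ] EuclideanSpace ℝ (Fin n) :=
  fderiv ℝ (transition n x p) (extChartAt (𝓡 n) x p)

omit [IsManifold (𝓡 n) ∞ M] in
theorem extChartAt_mem_overlap {x p : M} (hp : p ∈ (extChartAt (𝓡 n) x).source) :
    extChartAt (𝓡 n) x p ∈ overlap n x p :=
  ⟨(extChartAt (𝓡 n) x).map_source hp, by
    rw [mem_preimage, (extChartAt (𝓡 n) x).left_inv hp]
    exact mem_extChartAt_source p⟩

omit [IsManifold (𝓡 n) ∞ M] in
theorem transition_extChartAt {x p : M} (hp : p ∈ (extChartAt (𝓡 n) x).source) :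
    transition n x p (extChartAt (𝓡 n) x p) = extChartAt (𝓡 n) p p := by
  rw [transition, Function.comp_apply, (extChartAt (𝓡 n) x).left_inv hp]

theorem isInvertible_chartJacobian {x p : M} (hp : p ∈ (extChartAt (𝓡 n) x).source) :
    (chartJacobian n x p).IsInvertible :=
  isInvertible_fderiv_transition (extChartAt_mem_overlap hp)

theorem form_bilinearComp_chartJacobian (g : LorentzMetric n M) {x p : M}
    (hp : p ∈ (extChartAt (𝓡 n) x).source) :
    (g.form p).bilinearComp (chartJacobian n x p) (chartJacobian n x p) =
      g.inChart x (extChartAt (𝓡 n) x p) := by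
  rw [g.inChart_eq_pullback (extChartAt_mem_overlap hp), transition_extChartAt hp, inChart_center]
  rfl

theorem ricci_bilinearComp_chartJacobian (g : LorentzMetric n M) {x p : M}
    (hp : p ∈ (extChartAt (𝓡 n) x).source) :
    (g.ricci p).bilinearComp (chartJacobian n x p) (chartJacobian n x p) =
      g.ricciInChart x (extChartAt (𝓡 n) x p) := by
  rw [g.ricciInChart_eq_pullback (extChartAt_mem_overlap hp), transition_extChartAt hp]
  rfl

theorem trace_eq_formTrace_inChart (g : LorentzMetric n M) {x p : M}
    (hp : p ∈ (extChartAt (𝓡 n) x).source)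
    (B : EuclideanSpace ℝ (Fin n) →L[ℝ] EuclideanSpace ℝ (Fin n) →L[ℝ] ℝ) :
    g.trace p B = formTrace (g.inChart x (extChartAt (𝓡 n) x p))
      (B.bilinearComp (chartJacobian n x p) (chartJacobian n x p)) := by
  rw [← g.form_bilinearComp_chartJacobian hp,
    formTrace_bilinearComp (g.isInvertible_form p) (isInvertible_chartJacobian hp)]
  rfl

theorem continuousAt_formTrace_inChart (g : LorentzMetric n M) {x : M}
    {B : M → EuclideanSpace ℝ (Fin n) →L[ℝ] EuclideanSpace ℝ (Fin n) →L[ℝ] ℝ} {p : M}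
    (hp : p ∈ (extChartAt (𝓡 n) x).source) (hB : ContinuousAt B p) :
    ContinuousAt (fun q ↦ formTrace (g.inChart x (extChartAt (𝓡 n) x q)) (B q)) p := by
  have hp' := (extChartAt (𝓡 n) x).map_source hp
  have h1 : ContinuousAt (fun z ↦ (g.inChart x z).inverse) (extChartAt (𝓡 n) x p) :=
    (ContDiffAt.comp (n := ∞) _ (g.isInvertible_inChart hp').contDiffAt_map_inverse
      (g.contDiffAt_inChart hp')).continuousAt
  have h2 : ContinuousAt (fun q ↦ (g.inChart x (extChartAt (𝓡 n) x q)).inverse) p :=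
    ContinuousAt.comp (f := extChartAt (𝓡 n) x) h1 (continuousAt_extChartAt' hp)
  exact continuous_trace_clm.continuousAt.comp (h2.clm_comp hB)

/-- The scalar curvature is a continuous function. Its value at each point is defined through the
preferred chart at that point, so this rests on the tensorial nature of the Ricci form. -/
theorem continuous_scalarCurvature (g : LorentzMetric n M) : Continuous g.scalarCurvature := by
  refine continuous_iff_continuousAt.2 fun x ↦ ?_
  have hx := mem_extChartAt_source (I := 𝓡 n) x
  have hR : ContinuousAt (fun p ↦ g.ricciInChart x (extChartAt (𝓡 n) x p)) x :=
    ContinuousAt.comp (f := extChartAt (𝓡 n) x)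
      ((g.continuousOn_ricciInChart x).continuousAt
        ((isOpen_extChartAt_target x).mem_nhds (mem_extChartAt_target x)))
      (continuousAt_extChartAt x)
  refine (g.continuousAt_formTrace_inChart hx hR).congr ?_
  filter_upwards [extChartAt_source_mem_nhds (I := 𝓡 n) x] with p hp
  rw [← g.ricci_bilinearComp_chartJacobian hp, ← g.trace_eq_formTrace_inChart hp]
  rfl

/-! ### Functions on the manifold -/

omit [IsManifold (𝓡 n) ∞ M] in
theorem contDiffAt_comp_extChartAt_symm [IsManifold (𝓡 n) 2 M] {φ : M → ℝ}
    (hφ : ContMDiff (𝓡 n) 𝓘(ℝ, ℝ) 2 φ) {x : M} {y : EuclideanSpace ℝ (Fin n)}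
    (hy : y ∈ (extChartAt (𝓡 n) x).target) :
    ContDiffAt ℝ 2 (φ ∘ (extChartAt (𝓡 n) x).symm) y :=
  (hφ.contMDiffAt.comp y ((contMDiffOn_extChartAt_symm (n := 2) x).contMDiffAt
    ((isOpen_extChartAt_target x).mem_nhds hy))).contDiffAt

theorem grad_comp_chartJacobian {φ : M → ℝ} (hφ : ContMDiff (𝓡 n) 𝓘(ℝ, ℝ) 2 φ) {x p : M}
    (hp : p ∈ (extChartAt (𝓡 n) x).source) :
    (grad φ p : EuclideanSpace ℝ (Fin n) →L[ℝ] ℝ) ∘L chartJacobian n x p =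
      fderiv ℝ (φ ∘ (extChartAt (𝓡 n) x).symm) (extChartAt (𝓡 n) x p) := by
  have : IsManifold (𝓡 n) 2 M := .of_le (n := ∞) (by norm_cast)
  have hy := extChartAt_mem_overlap hp
  have hd := (contDiffAt_comp_extChartAt_symm hφ (transition_mem_overlap hy).1).differentiableAt
    two_ne_zero
  have h := fderiv_comp _ hd (differentiableAt_transition hy)
  rw [transition_extChartAt hp] at h
  refine h.symm.trans (Filter.EventuallyEq.fderiv_eq ?_)
  filter_upwards [(isOpen_overlap x p).mem_nhds hy] with z hz
  simp only [Function.comp_apply, symm_transition hz]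

theorem gradSq_eq_trace (g : LorentzMetric n M) (φ : M → ℝ) (p : M) :
    g.gradSq φ p = g.trace p ((grad φ p).smulRight (grad φ p)) :=
  (formTrace_smulRight _ _).symm

theorem continuous_gradSq (g : LorentzMetric n M) {φ : M → ℝ}
    (hφ : ContMDiff (𝓡 n) 𝓘(ℝ, ℝ) 2 φ) : Continuous (g.gradSq φ) := by
  have : IsManifold (𝓡 n) 2 M := .of_le (n := ∞) (by norm_cast)
  refine continuous_iff_continuousAt.2 fun x ↦ ?_
  have hd : ContinuousAt (fun p ↦ fderiv ℝ (φ ∘ (extChartAt (𝓡 n) x).symm)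
      (extChartAt (𝓡 n) x p)) x :=
    ContinuousAt.comp (f := extChartAt (𝓡 n) x)
      ((contDiffAt_comp_extChartAt_symm hφ (mem_extChartAt_target x)).fderiv_right (m := 1)
        le_rfl).continuousAt (continuousAt_extChartAt x)
  have hB : ContinuousAt (fun p ↦ (fderiv ℝ (φ ∘ (extChartAt (𝓡 n) x).symm)
      (extChartAt (𝓡 n) x p)).smulRight (fderiv ℝ (φ ∘ (extChartAt (𝓡 n) x).symm)
      (extChartAt (𝓡 n) x p))) x :=
    ((ContinuousLinearMap.smulRightL ℝ (EuclideanSpace ℝ (Fin n))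
      (EuclideanSpace ℝ (Fin n) →L[ℝ] ℝ)).continuous.continuousAt.comp hd).clm_apply hd
  refine (g.continuousAt_formTrace_inChart (mem_extChartAt_source x) hB).congr ?_
  filter_upwards [extChartAt_source_mem_nhds (I := 𝓡 n) x] with p hp
  rw [gradSq_eq_trace, g.trace_eq_formTrace_inChart hp, ← grad_comp_chartJacobian hφ hp]
  rfl

end Charts

section Observers

variable {n : ℕ} {M : Type*} [TopologicalSpace M]
  [ChartedSpace (EuclideanSpace ℝ (Fin n)) M] [IsManifold (𝓡 n) ∞ M]

/-! ### The effective energy density at a point -/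

/-- Reversed Cauchy–Schwarz inequality for a unit timelike vector, in Lorentzian coordinates: `z₀`
and `w₀` are the time components, and `a`, `b`, `s` the scalar products of the space components. -/
theorem sq_sub_le_of_sq_sub_eq_one {z₀ w₀ a b s : ℝ} (hb : 0 ≤ b) (ha : 0 ≤ a) (hs : s ^ 2 ≤ a * b)
    (hw : w₀ ^ 2 - b = 1) : z₀ ^ 2 - a ≤ (z₀ * w₀ - s) ^ 2 := by
  rcases hb.eq_or_lt with rfl | hb
  · have : s = 0 := by nlinarith
    subst this
    nlinarith
  · -- `b` times the difference of the two sides is at least `(z₀ b - w₀ s) ^ 2`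
    have h : 0 ≤ b * ((z₀ * w₀ - s) ^ 2 - (z₀ ^ 2 - a)) := by
      have h1 : b * ((z₀ * w₀ - s) ^ 2 - (z₀ ^ 2 - a)) =
          (z₀ * b - w₀ * s) ^ 2 + (a * b - s ^ 2) + b * z₀ ^ 2 * (w₀ ^ 2 - b - 1)
            - s ^ 2 * (w₀ ^ 2 - b - 1) := by ring
      rw [h1, hw]
      nlinarith [sq_nonneg (z₀ * b - w₀ * s)]
    linarith [nonneg_of_mul_nonneg_right h hb]

theorem form_self_le_sq (g : LorentzMetric n M) (hn : n ≠ 0) (p : M)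
    {U : EuclideanSpace ℝ (Fin n)} (hU : g.form p U U = 1) (z : EuclideanSpace ℝ (Fin n)) :
    g.form p z z ≤ g.form p z U ^ 2 := by
  obtain ⟨k, rfl⟩ := Nat.exists_eq_succ_of_ne_zero hn
  obtain ⟨e, he⟩ := g.exists_orthonormal_basis p
  have key : ∀ v w, g.form p v w = e.repr v 0 * e.repr w 0
      - ∑ i : Fin k, e.repr v i.succ * e.repr w i.succ := by
    intro v w
    conv_lhs => rw [← e.sum_repr v, ← e.sum_repr w]
    simp only [map_sum, map_smul, sum_apply, smul_apply, he, smul_eq_mul, mul_ite, mul_zero,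
      Finset.sum_ite_eq', Finset.mem_univ, if_true]
    simp [Fin.sum_univ_succ, mul_comm, sub_eq_add_neg]
  rw [key] at hU
  rw [key, key]
  simp only [← pow_two] at hU ⊢
  exact sq_sub_le_of_sq_sub_eq_one (Finset.sum_nonneg fun i _ ↦ sq_nonneg _)
    (Finset.sum_nonneg fun i _ ↦ sq_nonneg _) (Finset.sum_mul_sq_le_sq_mul_sq _ _ _) hU

theorem gradSq_le (g : LorentzMetric n M) (hn : n ≠ 0) (φ : M → ℝ) (p : M)
    {U : EuclideanSpace ℝ (Fin n)} (hU : g.form p U U = 1) :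
    g.gradSq φ p ≤ (grad φ p U) ^ 2 := by
  have h : ∀ w, g.form p ((g.form p).inverse (grad φ p)) w = grad φ p w := fun w ↦ by
    rw [(g.isInvertible_form p).self_apply_inverse]
  have := g.form_self_le_sq hn p hU ((g.form p).inverse (grad φ p))
  rwa [h, h] at this

theorem grad_sq {φ : M → ℝ} (hφ : ContMDiff (𝓡 n) 𝓘(ℝ, ℝ) 2 φ) (p : M) :
    (grad (fun q ↦ φ q ^ 2) p : EuclideanSpace ℝ (Fin n) →L[ℝ] ℝ) = (2 * φ p) • grad φ p := by
  have : IsManifold (𝓡 n) 2 M := .of_le (n := ∞) (by norm_cast)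
  have hd := (contDiffAt_comp_extChartAt_symm hφ (mem_extChartAt_target p)).differentiableAt
    two_ne_zero
  have h := (hd.hasFDerivAt.pow 2).fderiv
  refine h.trans ?_
  simp [grad]

/-- The Leibniz rule `∇_μ∇_ν φ² = 2 φ ∇_μ∇_ν φ + 2 (∇_μ φ)(∇_ν φ)`. -/
theorem hess_sq (g : LorentzMetric n M) {φ : M → ℝ} (hφ : ContMDiff (𝓡 n) 𝓘(ℝ, ℝ) 2 φ) (p : M) :
    g.hess (fun q ↦ φ q ^ 2) p =
      (2 * φ p) • g.hess φ p + (2 : ℝ) • (grad φ p).smulRight (grad φ p) := by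
  have : IsManifold (𝓡 n) 2 M := .of_le (n := ∞) (by norm_cast)
  set Φ := φ ∘ (extChartAt (𝓡 n) p).symm with hΦ
  set y := extChartAt (𝓡 n) p p
  have hC : ContDiffAt ℝ 2 Φ y := contDiffAt_comp_extChartAt_symm hφ (mem_extChartAt_target p)
  have hd : HasFDerivAt Φ (fderiv ℝ Φ y) y := (hC.differentiableAt two_ne_zero).hasFDerivAt
  have hd2 : HasFDerivAt (fderiv ℝ Φ) (fderiv ℝ (fderiv ℝ Φ) y) y :=
    ((hC.fderiv_right (m := 1) le_rfl).differentiableAt one_ne_zero).hasFDerivAt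
  have h1 : fderiv ℝ (fun z ↦ Φ z ^ 2) =ᶠ[𝓝 y] fun z ↦ (2 * Φ z) • fderiv ℝ Φ z := by
    filter_upwards [(hC.eventually (by simp))] with z hz
    rw [((hz.differentiableAt two_ne_zero).hasFDerivAt.pow 2).fderiv]
    simp
  have h2 : fderiv ℝ (fderiv ℝ (fun z ↦ Φ z ^ 2)) y =
      (2 * Φ y) • fderiv ℝ (fderiv ℝ Φ) y + ((2 : ℝ) • fderiv ℝ Φ y).smulRight (fderiv ℝ Φ y) := by
    rw [h1.fderiv_eq]
    exact ((hd.const_mul 2).smul hd2).fderiv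
  have hΦy : Φ y = φ p := by simp [hΦ, y]
  ext v w
  have h3 : g.hess (fun q ↦ φ q ^ 2) p v w = fderiv ℝ (fderiv ℝ (fun z ↦ Φ z ^ 2)) y v w -
      grad (fun q ↦ φ q ^ 2) p (g.christoffel p y v w) := rfl
  have h4 : g.hess φ p v w = fderiv ℝ (fderiv ℝ Φ) y v w -
      grad φ p (g.christoffel p y v w) := rfl
  have h5 : grad φ p = fderiv ℝ Φ y := rfl
  simp only [add_apply, smul_apply, ContinuousLinearMap.smulRight_apply, h3, h4, h2, grad_sq hφ,
    hΦy, ← h5, smul_eq_mul]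
  ring

theorem trace_form (g : LorentzMetric n M) (p : M) : g.trace p (g.form p) = n := by
  rw [trace, formTrace_self (g.isInvertible_form p)]
  simp

/-- `□φ² = 2 φ □φ + 2 (∇φ)²`. -/
theorem box_sq (g : LorentzMetric n M) {φ : M → ℝ} (hφ : ContMDiff (𝓡 n) 𝓘(ℝ, ℝ) 2 φ) (p : M) :
    g.box (fun q ↦ φ q ^ 2) p = 2 * φ p * g.box φ p + 2 * g.gradSq φ p := by
  rw [box, hess_sq g hφ, gradSq_eq_trace, box]
  simp only [trace, formTrace_add, formTrace_smul]

/-- On a solution of the Klein–Gordon equation, the terms of `ρ` with `□φ²` and `(∇φ)²` partly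
cancel, and the scalar curvature survives only with a factor `ξ²`. -/
theorem effectiveEnergyDensity_eq (g : LorentzMetric n M) (hn : 3 ≤ n) {m ξ : ℝ} {φ : M → ℝ}
    (hφ : ContMDiff (𝓡 n) 𝓘(ℝ, ℝ) 2 φ) (hKG : g.IsKleinGordon m ξ φ) (p : M)
    {U : EuclideanSpace ℝ (Fin n)} (hU : g.form p U U = 1) :
    g.effectiveEnergyDensity m ξ φ p U =
      grad φ p U ^ 2 - (1 - 2 * ξ) / ((n : ℝ) - 2) * m ^ 2 * φ p ^ 2
        + 2 * ξ ^ 2 / ((n : ℝ) - 2) * g.scalarCurvature p * φ p ^ 2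
        - 2 * ξ / ((n : ℝ) - 2) * g.gradSq φ p
        - ξ * g.hess (fun q ↦ φ q ^ 2) p U U - ξ * g.ricci p U U * φ p ^ 2 := by
  have hn' : (n : ℝ) - 2 ≠ 0 := by
    have : (3 : ℝ) ≤ n := by exact_mod_cast hn
    linarith
  have hbox := g.box_sq hφ p
  have hT : g.trace p (g.stressEnergy m ξ φ p) = g.gradSq φ p
      + 1 / 2 * (m ^ 2 * φ p ^ 2 - g.gradSq φ p) * n
      + ξ * (g.box (fun q ↦ φ q ^ 2) p * n - g.box (fun q ↦ φ q ^ 2) p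
        - φ p ^ 2 * (g.scalarCurvature p - 1 / 2 * g.scalarCurvature p * n)) := by
    have h1 := gradSq_eq_trace g φ p
    have h2 := g.trace_form p
    have h3 : g.box (fun q ↦ φ q ^ 2) p = g.trace p (g.hess (fun q ↦ φ q ^ 2) p) := rfl
    have h4 : g.scalarCurvature p = g.trace p (g.ricci p) := rfl
    simp only [trace] at h1 h2 h3 h4 ⊢
    simp only [stressEnergy, einstein, formTrace_add, formTrace_sub, formTrace_smul, h2, ← h1,
      ← h3, ← h4]
  have hTU : g.stressEnergy m ξ φ p U U = grad φ p U ^ 2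
      + 1 / 2 * (m ^ 2 * φ p ^ 2 - g.gradSq φ p)
      + ξ * (g.box (fun q ↦ φ q ^ 2) p - g.hess (fun q ↦ φ q ^ 2) p U U
        - φ p ^ 2 * (g.ricci p U U - 1 / 2 * g.scalarCurvature p)) := by
    simp only [stressEnergy, einstein, add_apply, sub_apply, smul_apply,
      ContinuousLinearMap.smulRight_apply, smul_eq_mul, hU]
    ring
  have hK : g.box φ p = -(m ^ 2 * φ p) - ξ * g.scalarCurvature p * φ p := by
    linarith [hKG p]
  rw [effectiveEnergyDensity, hT, hTU, hbox, hK]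
  field_simp
  ring

/-! ### Restriction to a geodesic -/

theorem contDiffAt_extChartAt_comp {γ : ℝ → M} {I : Set ℝ}
    (hI : IsOpen I) (hγ : ContMDiffOn 𝓘(ℝ, ℝ) (𝓡 n) 2 γ I) {τ : ℝ} (hτ : τ ∈ I) {x : M}
    (hx : γ τ ∈ (extChartAt (𝓡 n) x).source) :
    ContDiffAt ℝ 2 (fun s ↦ extChartAt (𝓡 n) x (γ s)) τ := by
  have : IsManifold (𝓡 n) 2 M := .of_le (n := ∞) (by norm_cast)
  exact ((contMDiffAt_extChartAt' (by rwa [← extChartAt_source (𝓡 n)])).comp τ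
    (hγ.contMDiffAt (hI.mem_nhds hτ))).contDiffAt

omit [IsManifold (𝓡 n) ∞ M] in
theorem velocity_eq_deriv {γ : ℝ → M} {I : Set ℝ} (hI : IsOpen I)
    (hγ : ContMDiffOn 𝓘(ℝ, ℝ) (𝓡 n) 2 γ I) {τ : ℝ} (hτ : τ ∈ I) :
    (velocity γ τ : EuclideanSpace ℝ (Fin n)) = deriv (inCoordinates γ τ) τ := by
  have hd : MDifferentiableAt 𝓘(ℝ, ℝ) (𝓡 n) γ τ :=
    (hγ.contMDiffAt (hI.mem_nhds hτ)).mdifferentiableAt (by simp)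
  have h := congrArg (fun A : ℝ →L[ℝ] EuclideanSpace ℝ (Fin n) ↦ A 1) hd.mfderiv
  refine h.trans ?_
  simp only [modelWithCornersSelf_coe, range_id, fderivWithin_univ]
  rfl

theorem chartJacobian_deriv {γ : ℝ → M} {I : Set ℝ} (hI : IsOpen I)
    (hγ : ContMDiffOn 𝓘(ℝ, ℝ) (𝓡 n) 2 γ I) {τ : ℝ} (hτ : τ ∈ I) {x : M}
    (hx : γ τ ∈ (extChartAt (𝓡 n) x).source) :
    chartJacobian n x (γ τ) (deriv (fun s ↦ extChartAt (𝓡 n) x (γ s)) τ) = velocity γ τ := by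
  have hc := (contDiffAt_extChartAt_comp hI hγ hτ hx).differentiableAt two_ne_zero
  have hy := extChartAt_mem_overlap hx
  rw [velocity_eq_deriv hI hγ hτ]
  have h := (differentiableAt_transition hy).hasFDerivAt.comp_hasDerivAt τ hc.hasDerivAt
  rw [chartJacobian, ← h.deriv]
  refine Filter.EventuallyEq.deriv_eq ?_
  have hcont : ContinuousAt γ τ := (hγ.contMDiffAt (hI.mem_nhds hτ)).continuousAt
  filter_upwards [hcont.preimage_mem_nhds (extChartAt_source_mem_nhds' hx)] with s hs
  simp only [Function.comp_apply, transition, inCoordinates]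
  rw [(extChartAt (𝓡 n) x).left_inv hs]

theorem continuousOn_ricci_velocity (g : LorentzMetric n M) {γ : ℝ → M} {I : Set ℝ}
    (hI : IsOpen I) (hγ : ContMDiffOn 𝓘(ℝ, ℝ) (𝓡 n) 2 γ I) :
    ContinuousOn (fun τ ↦ g.ricci (γ τ) (velocity γ τ) (velocity γ τ)) I := by
  intro τ hτ
  refine ContinuousAt.continuousWithinAt ?_
  have hx := mem_extChartAt_source (I := 𝓡 n) (γ τ)
  have hcont : ContinuousAt γ τ := (hγ.contMDiffAt (hI.mem_nhds hτ)).continuousAt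
  have hc := contDiffAt_extChartAt_comp hI hγ hτ hx
  have hR : ContinuousAt (fun s ↦ g.ricciInChart (γ τ) (extChartAt (𝓡 n) (γ τ) (γ s))) τ :=
    ContinuousAt.comp (f := fun s ↦ extChartAt (𝓡 n) (γ τ) (γ s))
      ((g.continuousOn_ricciInChart (γ τ)).continuousAt
        ((isOpen_extChartAt_target (γ τ)).mem_nhds (mem_extChartAt_target (γ τ))))
      hc.continuousAt
  have hv : ContinuousAt (deriv fun s ↦ extChartAt (𝓡 n) (γ τ) (γ s)) τ :=
    (hc.derivWithin (m := 1) le_rfl).continuousAt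
  refine ((hR.clm_apply hv).clm_apply hv).congr ?_
  filter_upwards [hcont.preimage_mem_nhds (extChartAt_source_mem_nhds (I := 𝓡 n) (γ τ)),
    hI.mem_nhds hτ] with s hs hsI
  rw [← chartJacobian_deriv hI hγ hsI hs, ← g.ricci_bilinearComp_chartJacobian hs]
  rfl

omit [IsManifold (𝓡 n) ∞ M] in
theorem contDiffOn_comp_curve {γ : ℝ → M} {I : Set ℝ} (hγ : ContMDiffOn 𝓘(ℝ, ℝ) (𝓡 n) 2 γ I)
    {φ : M → ℝ} (hφ : ContMDiff (𝓡 n) 𝓘(ℝ, ℝ) 2 φ) : ContDiffOn ℝ 2 (φ ∘ γ) I :=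
  (hφ.comp_contMDiffOn hγ).contDiffOn

theorem eventually_hasDerivAt_comp {γ : ℝ → M} {I : Set ℝ} (hI : IsOpen I)
    (hγ : ContMDiffOn 𝓘(ℝ, ℝ) (𝓡 n) 2 γ I) {φ : M → ℝ} (hφ : ContMDiff (𝓡 n) 𝓘(ℝ, ℝ) 2 φ)
    {τ : ℝ} (hτ : τ ∈ I) : ∀ᶠ s in 𝓝 τ, HasDerivAt (φ ∘ γ)
      (fderiv ℝ (φ ∘ (extChartAt (𝓡 n) (γ τ)).symm) (inCoordinates γ τ s)
        (deriv (inCoordinates γ τ) s)) s := by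
  have : IsManifold (𝓡 n) 2 M := .of_le (n := ∞) (by norm_cast)
  have hcont : ContinuousAt γ τ := (hγ.contMDiffAt (hI.mem_nhds hτ)).continuousAt
  filter_upwards [eventually_mem_nhds_iff.2 (hcont.preimage_mem_nhds
    (extChartAt_source_mem_nhds (I := 𝓡 n) (γ τ))), hI.mem_nhds hτ] with s hs hsI
  have hs' : γ s ∈ (extChartAt (𝓡 n) (γ τ)).source :=
    mem_of_mem_nhds (s := γ ⁻¹' _) hs
  have hc := (contDiffAt_extChartAt_comp hI hγ hsI hs').differentiableAt two_ne_zero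
  have hd := (contDiffAt_comp_extChartAt_symm hφ
    ((extChartAt (𝓡 n) (γ τ)).map_source hs')).differentiableAt two_ne_zero
  refine (hd.hasFDerivAt.comp_hasDerivAt s hc.hasDerivAt).congr_of_eventuallyEq ?_
  filter_upwards [hs] with r hr
  simp only [Function.comp_apply]
  rw [(extChartAt (𝓡 n) (γ τ)).left_inv hr]

theorem deriv_comp_curve {γ : ℝ → M} {I : Set ℝ} (hI : IsOpen I)
    (hγ : ContMDiffOn 𝓘(ℝ, ℝ) (𝓡 n) 2 γ I) {φ : M → ℝ} (hφ : ContMDiff (𝓡 n) 𝓘(ℝ, ℝ) 2 φ)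
    {τ : ℝ} (hτ : τ ∈ I) : deriv (φ ∘ γ) τ =
      (grad φ (γ τ) : EuclideanSpace ℝ (Fin n) →L[ℝ] ℝ) (velocity γ τ) := by
  rw [(eventually_hasDerivAt_comp hI hγ hφ hτ).self_of_nhds.deriv, velocity_eq_deriv hI hγ hτ]
  rfl

/-- Along a geodesic, the Hessian evaluated on the velocity is the second derivative. -/
theorem deriv_deriv_comp_geodesic (g : LorentzMetric n M) {γ : ℝ → M} {I : Set ℝ} (hI : IsOpen I)
    (hγ : g.IsGeodesicOn γ I) {φ : M → ℝ} (hφ : ContMDiff (𝓡 n) 𝓘(ℝ, ℝ) 2 φ)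
    {τ : ℝ} (hτ : τ ∈ I) :
    deriv (deriv (φ ∘ γ)) τ = g.hess φ (γ τ) (velocity γ τ) (velocity γ τ) := by
  have : IsManifold (𝓡 n) 2 M := .of_le (n := ∞) (by norm_cast)
  have hx := mem_extChartAt_source (I := 𝓡 n) (γ τ)
  have hc : ContDiffAt ℝ 2 (inCoordinates γ τ) τ := contDiffAt_extChartAt_comp hI hγ.1 hτ hx
  have hC : ContDiffAt ℝ 2 (φ ∘ (extChartAt (𝓡 n) (γ τ)).symm) (inCoordinates γ τ τ) :=
    contDiffAt_comp_extChartAt_symm hφ (mem_extChartAt_target (γ τ))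
  have hd1 : HasDerivAt (inCoordinates γ τ) (deriv (inCoordinates γ τ) τ) τ :=
    (hc.differentiableAt two_ne_zero).hasDerivAt
  have hd2 : HasDerivAt (deriv (inCoordinates γ τ)) (deriv (deriv (inCoordinates γ τ)) τ) τ :=
    ((hc.derivWithin (m := 1) le_rfl).differentiableAt one_ne_zero).hasDerivAt
  have hD : HasFDerivAt (fderiv ℝ (φ ∘ (extChartAt (𝓡 n) (γ τ)).symm))
      (fderiv ℝ (fderiv ℝ (φ ∘ (extChartAt (𝓡 n) (γ τ)).symm)) (inCoordinates γ τ τ))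
      (inCoordinates γ τ τ) :=
    ((hC.fderiv_right (m := 1) le_rfl).differentiableAt one_ne_zero).hasFDerivAt
  have h1 : deriv (φ ∘ γ) =ᶠ[𝓝 τ] fun s ↦
      fderiv ℝ (φ ∘ (extChartAt (𝓡 n) (γ τ)).symm) (inCoordinates γ τ s)
        (deriv (inCoordinates γ τ) s) :=
    (eventually_hasDerivAt_comp hI hγ.1 hφ hτ).mono fun s hs ↦ hs.deriv
  have h2 := (hD.comp_hasDerivAt τ hd1).clm_apply hd2
  rw [h1.deriv_eq]
  refine h2.deriv.trans ?_
  rw [eq_neg_of_add_eq_zero_left (hγ.2 τ hτ), velocity_eq_deriv hI hγ.1 hτ, map_neg,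
    ← sub_eq_add_neg]
  rfl

end Observers

end LorentzMetric

/-! ### Integration along the curve -/

/-- A function that is continuous on an open set `I` and vanishes off the support of a function
whose compact support lies in `I` is integrable. -/
theorem integrable_of_continuousOn_of_support_subset {f F : ℝ → ℝ} {I : Set ℝ} (hI : IsOpen I)
    (hfc : HasCompactSupport f) (hfI : tsupport f ⊆ I) (hF : ContinuousOn F I)
    (hsupp : Function.support F ⊆ tsupport f) : Integrable F := by
  have hts : tsupport F ⊆ tsupport f := closure_minimal hsupp (isClosed_tsupport f)
  have hcont : Continuous F := continuous_of_tsupport fun τ hτ ↦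
    hF.continuousAt (hI.mem_nhds (hfI (hts hτ)))
  exact hcont.integrable_of_hasCompactSupport (hfc.mono' hsupp)

/-- Integration by parts against `f ^ 2`, without boundary terms. -/
theorem integral_deriv_sq_mul_deriv_eq_zero {f W : ℝ → ℝ} {I : Set ℝ} (hI : IsOpen I)
    (hf : ContDiff ℝ 1 f) (hfc : HasCompactSupport f) (hfI : tsupport f ⊆ I)
    (hW : ContDiffOn ℝ 2 W I) :
    Integrable (fun τ ↦ 2 * f τ * deriv f τ * deriv W τ + f τ ^ 2 * deriv (deriv W) τ) ∧
      ∫ τ, (2 * f τ * deriv f τ * deriv W τ + f τ ^ 2 * deriv (deriv W) τ) = 0 := by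
  have hf' : Continuous (deriv f) := hf.continuous_deriv le_rfl
  have hW1 : ContDiffOn ℝ 1 (deriv W) I := hW.deriv_of_isOpen hI (by norm_num)
  have hW2 : ContinuousOn (deriv (deriv W)) I := hW1.continuousOn_deriv_of_isOpen hI le_rfl
  have hzero : ∀ τ ∉ tsupport f, f τ = 0 := fun τ ↦ image_eq_zero_of_notMem_tsupport
  have hint : Integrable fun τ ↦
      2 * f τ * deriv f τ * deriv W τ + f τ ^ 2 * deriv (deriv W) τ := by
    refine integrable_of_continuousOn_of_support_subset hI hfc hfI ?_ ?_
    · exact ((((continuous_const.mul hf.continuous).mul hf').continuousOn.mul hW1.continuousOn).add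
        ((hf.continuous.pow 2).continuousOn.mul hW2))
    · refine Function.support_subset_iff'.2 fun τ hτ ↦ ?_
      simp [hzero τ hτ]
  have hint' : Integrable fun τ ↦ f τ ^ 2 * deriv W τ := by
    refine integrable_of_continuousOn_of_support_subset hI hfc hfI
      ((hf.continuous.pow 2).continuousOn.mul hW1.continuousOn) ?_
    refine Function.support_subset_iff'.2 fun τ hτ ↦ ?_
    simp [hzero τ hτ]
  refine ⟨hint, integral_eq_zero_of_hasDerivAt_of_integrable (fun τ ↦ ?_) hint hint'⟩
  by_cases hτ : τ ∈ tsupport f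
  · have h1 := ((hf.differentiable one_ne_zero τ).hasDerivAt.pow 2)
    have h2 := ((hW1.contDiffAt (hI.mem_nhds (hfI hτ))).differentiableAt one_ne_zero).hasDerivAt
    refine (h1.mul h2).congr_deriv ?_
    simp
  · -- `f` vanishes near `τ`, although `deriv W` need not be differentiable there
    have hev : (fun τ ↦ f τ ^ 2 * deriv W τ) =ᶠ[𝓝 τ] fun _ ↦ 0 := by
      filter_upwards [(isClosed_tsupport f).isOpen_compl.mem_nhds hτ] with s hs
      simp [hzero s hs]
    refine ((hasDerivAt_const τ (0 : ℝ)).congr_of_eventuallyEq hev).congr_deriv ?_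
    simp [hzero τ hτ]

/-- The quadratic form left over after the integration by parts is nonnegative for
`0 ≤ ξ ≤ 2 ξ_c`: its discriminant condition is exactly `ξ ≤ 2 ξ_c`. -/
theorem quadratic_nonneg_of_mem_Icc {n : ℕ} (hn : 3 ≤ n) {ξ : ℝ}
    (hξ : ξ ∈ Icc 0 (2 * conformalCoupling n)) (a b : ℝ) :
    0 ≤ (1 - 2 * ξ / ((n : ℝ) - 2)) * a ^ 2 + 4 * ξ * a * b + 2 * ξ * b ^ 2 := by
  have hn' : (3 : ℝ) ≤ n := by exact_mod_cast hn
  have h2 : (0 : ℝ) < n - 2 := by linarith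
  have h1 : (0 : ℝ) < n - 1 := by linarith
  have hξ' : 2 * ξ ≤ 1 - 2 * ξ / ((n : ℝ) - 2) := by
    have h := hξ.2
    rw [conformalCoupling, ← mul_div_assoc, le_div_iff₀ (by positivity)] at h
    rw [le_sub_iff_add_le, ← le_sub_iff_add_le', div_le_iff₀ h2]
    linarith
  -- replacing the coefficient of `a ^ 2` by `2 ξ` leaves `2 ξ (a + b) ^ 2`
  nlinarith [mul_nonneg hξ.1 (sq_nonneg (a + b)),
    mul_nonneg (sub_nonneg.2 hξ') (sq_nonneg a)]

/-! ### The lower bound along a geodesic -/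

theorem theorem1 {n : ℕ} (hn : 3 ≤ n) {M : Type*} [TopologicalSpace M]
    [ChartedSpace (EuclideanSpace ℝ (Fin n)) M] [IsManifold (𝓡 n) ∞ M]
    (g : LorentzMetric n M) (m ξ : ℝ) (hξ : ξ ∈ Icc 0 (2 * conformalCoupling n))
    (φ : M → ℝ) (hφ : ContMDiff (𝓡 n) 𝓘(ℝ, ℝ) 2 φ) (hKG : g.IsKleinGordon m ξ φ)
    (I : Set ℝ) (hIopen : IsOpen I) (hIconn : I.OrdConnected)
    (γ : ℝ → M) (hγ : g.IsProperTimelikeGeodesicOn γ I)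
    (f : ℝ → ℝ) (hf : ContDiff ℝ 2 f) (hfc : HasCompactSupport f) (hfI : tsupport f ⊆ I) :
    IntegrableOn (fun τ ↦ g.effectiveEnergyDensity m ξ φ (γ τ) (LorentzMetric.velocity γ τ) * f τ ^ 2) I ∧
    IntegrableOn (fun τ ↦
      ((1 - 2 * ξ) / ((n : ℝ) - 2) * m ^ 2 * f τ ^ 2
        + ξ * (2 * deriv f τ ^ 2
          + g.ricci (γ τ) (LorentzMetric.velocity γ τ) (LorentzMetric.velocity γ τ) * f τ ^ 2
          - 2 * ξ / ((n : ℝ) - 2) * g.scalarCurvature (γ τ) * f τ ^ 2)) * φ (γ τ) ^ 2) I ∧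
    -(∫ τ in I,
      ((1 - 2 * ξ) / ((n : ℝ) - 2) * m ^ 2 * f τ ^ 2
        + ξ * (2 * deriv f τ ^ 2
          + g.ricci (γ τ) (LorentzMetric.velocity γ τ) (LorentzMetric.velocity γ τ) * f τ ^ 2
          - 2 * ξ / ((n : ℝ) - 2) * g.scalarCurvature (γ τ) * f τ ^ 2)) * φ (γ τ) ^ 2)
      ≤ ∫ τ in I, g.effectiveEnergyDensity m ξ φ (γ τ) (LorentzMetric.velocity γ τ) * f τ ^ 2 := by

  obtain ⟨hgeo, hunit⟩ := hγ
  have hγ2 := hgeo.1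
  have hn' : (3 : ℝ) ≤ n := by exact_mod_cast hn
  have hn2 : (0 : ℝ) < (n : ℝ) - 2 := by linarith
  have hφ2 : ContMDiff (𝓡 n) 𝓘(ℝ, ℝ) 2 fun p ↦ φ p ^ 2 :=
    (contDiff_id.pow 2).contMDiff.comp hφ
  have hu := LorentzMetric.contDiffOn_comp_curve hγ2 hφ
  have hW := LorentzMetric.contDiffOn_comp_curve hγ2 hφ2
  set W : ℝ → ℝ := (fun p ↦ φ p ^ 2) ∘ γ with hWdef
  have hR := g.continuous_scalarCurvature.comp_continuousOn hγ2.continuousOn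
  have hG := (g.continuous_gradSq hφ).comp_continuousOn hγ2.continuousOn
  have hRic := g.continuousOn_ricci_velocity hIopen hγ2
  have hu1 : ContinuousOn (deriv (φ ∘ γ)) I := hu.continuousOn_deriv_of_isOpen hIopen (by norm_num)
  have hW2 : ContinuousOn (deriv (deriv W)) I :=
    (hW.deriv_of_isOpen (m := 1) hIopen (by norm_num)).continuousOn_deriv_of_isOpen hIopen le_rfl
  have hWd : ∀ τ ∈ I, deriv W τ = 2 * φ (γ τ) * deriv (φ ∘ γ) τ := by
    intro τ hτ
    have h := ((hu.contDiffAt (hIopen.mem_nhds hτ)).differentiableAt two_ne_zero).hasDerivAt.pow 2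
    refine h.deriv.trans ?_
    simp
  have hρ : ∀ τ ∈ I, g.effectiveEnergyDensity m ξ φ (γ τ) (LorentzMetric.velocity γ τ) =
      deriv (φ ∘ γ) τ ^ 2 - (1 - 2 * ξ) / ((n : ℝ) - 2) * m ^ 2 * φ (γ τ) ^ 2
        + 2 * ξ ^ 2 / ((n : ℝ) - 2) * g.scalarCurvature (γ τ) * φ (γ τ) ^ 2
        - 2 * ξ / ((n : ℝ) - 2) * g.gradSq φ (γ τ) - ξ * deriv (deriv W) τ
        - ξ * g.ricci (γ τ) (LorentzMetric.velocity γ τ) (LorentzMetric.velocity γ τ)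
          * φ (γ τ) ^ 2 := by
    intro τ hτ
    rw [g.effectiveEnergyDensity_eq hn hφ hKG (γ τ) (hunit τ hτ),
      ← LorentzMetric.deriv_comp_curve hIopen hγ2 hφ hτ,
      ← g.deriv_deriv_comp_geodesic hIopen hgeo hφ2 hτ]
  have huc : ContinuousOn (fun τ ↦ φ (γ τ)) I := hu.continuousOn
  have hf' : Continuous (deriv f) := hf.continuous_deriv (by norm_num)
  have hzero : ∀ τ ∉ tsupport f, f τ = 0 := fun τ ↦ image_eq_zero_of_notMem_tsupport
  have hzero' : ∀ τ ∉ tsupport f, deriv f τ = 0 := fun τ hτ ↦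
    Function.notMem_support.1 fun h ↦ hτ (support_deriv_subset h)
  have hint1 : Integrable fun τ ↦
      g.effectiveEnergyDensity m ξ φ (γ τ) (LorentzMetric.velocity γ τ) * f τ ^ 2 := by
    refine integrable_of_continuousOn_of_support_subset hIopen hfc hfI ?_ ?_
    · refine ContinuousOn.mul ?_ (hf.continuous.pow 2).continuousOn
      refine ContinuousOn.congr ?_ hρ
      exact (((((hu1.pow 2).sub (continuousOn_const.mul (huc.pow 2))).add
        ((continuousOn_const.mul hR).mul (huc.pow 2))).sub (continuousOn_const.mul hG)).sub
        (continuousOn_const.mul hW2)).sub ((continuousOn_const.mul hRic).mul (huc.pow 2))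
    · refine Function.support_subset_iff'.2 fun τ hτ ↦ ?_
      simp [hzero τ hτ]
  have hint2 : Integrable fun τ ↦
      ((1 - 2 * ξ) / ((n : ℝ) - 2) * m ^ 2 * f τ ^ 2
        + ξ * (2 * deriv f τ ^ 2
          + g.ricci (γ τ) (LorentzMetric.velocity γ τ) (LorentzMetric.velocity γ τ) * f τ ^ 2
          - 2 * ξ / ((n : ℝ) - 2) * g.scalarCurvature (γ τ) * f τ ^ 2)) * φ (γ τ) ^ 2 := by
    have hfc2 : ContinuousOn (fun τ ↦ f τ ^ 2) I := (hf.continuous.pow 2).continuousOn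
    refine integrable_of_continuousOn_of_support_subset hIopen hfc hfI ?_ ?_
    · exact ((continuousOn_const.mul hfc2).add (continuousOn_const.mul
        (((continuousOn_const.mul (hf'.continuousOn.pow 2)).add (hRic.mul hfc2)).sub
        ((continuousOn_const.mul hR).mul hfc2)))).mul (huc.pow 2)
    · refine Function.support_subset_iff'.2 fun τ hτ ↦ ?_
      simp [hzero τ hτ, hzero' τ hτ]
  obtain ⟨hint3, hparts⟩ := integral_deriv_sq_mul_deriv_eq_zero hIopen
    (hf.of_le (by norm_num)) hfc hfI hW
  have hpartsI : ∫ τ in I,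
      (2 * f τ * deriv f τ * deriv W τ + f τ ^ 2 * deriv (deriv W) τ) = 0 := by
    rw [setIntegral_eq_integral_of_forall_compl_eq_zero, hparts]
    intro τ hτ
    simp [hzero τ fun h ↦ hτ (hfI h)]
  refine ⟨hint1.integrableOn, hint2.integrableOn, ?_⟩
  rw [neg_le_iff_add_nonneg', ← integral_add hint2.integrableOn hint1.integrableOn]
  -- the sum of the two integrands dominates `-ξ` times the derivative of `f ^ 2 * deriv W`
  have hle := setIntegral_mono_on (hint3.const_mul (-ξ)).integrableOn
    (hint2.add hint1).integrableOn hIopen.measurableSet fun τ hτ ↦ ?_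
  · rwa [integral_const_mul, hpartsI, mul_zero] at hle
  · -- the integrands differ by the quadratic form in `f u'`, `f' u` and the Cauchy–Schwarz defect
    have hq := quadratic_nonneg_of_mem_Icc hn hξ (f τ * deriv (φ ∘ γ) τ) (deriv f τ * φ (γ τ))
    have hcs := g.gradSq_le (by omega) φ (γ τ) (hunit τ hτ)
    rw [← LorentzMetric.deriv_comp_curve hIopen hγ2 hφ hτ] at hcs
    have hcs' : 0 ≤ 2 * ξ / ((n : ℝ) - 2) * f τ ^ 2 *
        (deriv (φ ∘ γ) τ ^ 2 - g.gradSq φ (γ τ)) :=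
      mul_nonneg (mul_nonneg (div_nonneg (by linarith [hξ.1]) hn2.le) (sq_nonneg _))
        (sub_nonneg.2 hcs)
    simp only [Pi.add_apply]
    rw [hρ τ hτ, hWd τ hτ]
    linear_combination hq + hcs'
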